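/- **Setting.** Let $\mathrm{Loc}$ be a set of locations and $V$ a set of values. A *pomset* over $L$ is a strict poset $(P,<_P)$ of occurrences with a labelling $\Phi_P:P\to L$, taken up to label-preserving order isomorphism. $P\parallel Q$ is the disjoint union; $P;Q$ in addition puts all of $P$ below all of $Q$ (and $P;Q=P$ if $P$ is infinite). Program-order actions $\mathcal A_{PO}$ are global writes $x:=v$, reads $x=v$, and the skip $\delta$; TSO actions $\mathcal A_{TSO}$ are these and the buffer writes $\bar x:=v$. **Program orders.** Programs are the commands $c::=\mathbf{skip}\mid x:=e\mid c;c\mid c\parallel c\mid \mathbf{if}\,b\,\mathbf{then}\,c\,\mathbf{else}\,c\mid\mathbf{while}\,b\,\mathbf{do}\,c$ over value and boolean expressions built from constants, locations and operators. $\mathcal P_{PO}$ is defined by recursion: constants and $\mathbf{skip}$ give $\{\delta\}$; an expression $x$ gives $\{x=v\}$ with value $v$, for every $v\in V$; a binary operator gives $P_1\parallel P_2$ and the value computed from the values of the operands; unary operators keep the pomset; $x:=e$ gives $P;\{x:=v\}$ where $e$ gives $P$ with value $v$; $c_1;c_2$ and $c_1\parallel c_2$ are composed accordingly; a conditional gives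 a pomset of $b$ with value true followed by one of the first branch, or one with value false followed by one of the second; a loop gives all finite and infinite unrollings. Program orders are identified when deleting finitely many $\delta$ from each yields the same non-empty pomset; $\mathcal P_{PO}(p)$ contains every representative. **TSO-consistency.** A strict partial order $<_T$ on the occurrences of $P$ is *TSO-consistent* with $P$ if, for some finite partial function $\sigma:\mathrm{Loc}\rightharpoonup V$ (with $\downarrow_< s=\{s'\mid s'<s\}\cup\{s\}$): (O) $<_T$ totally orders the writes of $P$; (V) for each read $r=(x=v)$, either (a) some write $w=(x:=v)$ is $<_T$-maximal among the writes to $x$ in $\downarrow_T r$, and all writes to $x$ in $\downarrow_P r$ lie in $\downarrow_T w$; or (b) some write $w=(x:=v)$ is $<_P$-maximal among the writes to $x$ in $\downarrow_P r$, and $r<_T w$; or (c) there is no write to $x$ in $\downarrow_T r$ or $\downarrow_P r$, and $\sigma(x)=v$; (L) $r<_P a$ implies $r<_T a$ for each read $r$ and each $a$; (S) $w<_P w'$ implies $w<_T w'$ for writes $w,w'$; (F) if $a_1<_P a_2$, $a_1<_P a_3$ and $a_2,a_3$ are incomparable in $P$, then $a_1<_T a_2$ and $a_1<_T a_3$; (J)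 if $a_1<_P a_3$, $a_2<_P a_3$ and $a_1,a_2$ are incomparable in $P$, then $a_1<_T a_3$ and $a_2<_T a_3$. **Footprints.** A buffered state is a pair of finite partial functions, one assigning to buffer locations $\bar x$ values $v_n$ ($v\in V$, $n\in\mathbb N$, all $v_0$ being identified) and one assigning to locations $x$ values in $V$. $\zeta(\sigma)$ means that every buffer location in the domain has a value $v_0$. Write $[\sigma\mid\tau]$ for $\sigma$ overwritten by $\tau$, and $\sigma\Uparrow\tau$ if $\sigma,\tau$ agree on their common domain. Footsteps are pairs of states, with $(\sigma_1,\tau_1)\lhd(\sigma_2,\tau_2)=(\sigma_1\cup(\sigma_2\setminus\mathrm{dom}\,\tau_1),[\tau_1\mid\tau_2])$, defined if $[\sigma_1\mid\tau_1]\Uparrow\sigma_2$, and lifted to sets. The footprints of actions, for all $v',v''\in V$ and $n\in\mathbb N$, are: for $x=v$, $([x:v,\bar x:v_0],[\,])$ and $([\bar x:v_{n+1}],[\,])$; for $\bar x:=v$, $([\bar x:v'_n],[\bar x:v_{n+1}])$; for $x:=v$, $([x:v',\bar x:v''_{n+1}],[x:v,\bar x:v''_n])$; for $\delta$, $([\,],[\,])$.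 For a list $E$ of global writes, $[\![E]\!]^*$ is the $\lhd$-composition in order of the sets $\{([x:v'],[x:v])\mid v'\in V\}$ for its entries $x:=v$ (and $\{([\,],[\,])\}$ for the empty list). For a list $\Lambda$ that is a linearisation of a pomset $P$ over $\mathcal A_{TSO}$ interspersed with foreign global writes, $[\![P]\!]_\Lambda$ is the least set such that: (Act) if $P=\{\lambda\}$ and $\Lambda=\Lambda_1;\lambda;\Lambda_2$, it contains $[\![\Lambda_1]\!]^*\lhd[\![\lambda]\!]\lhd[\![\Lambda_2]\!]^*$; (Seq) if $P=P_1;P_2$ and $\Lambda=\Lambda_1;\Lambda_2$, it contains $[\![P_1]\!]_{\Lambda_1}\lhd[\![P_2]\!]_{\Lambda_2}$; (Par) if $P=P_1\parallel P_2$, $\Lambda_i$ arises from $\Lambda$ by deleting the actions of the other component other than its global writes (which become foreign), $(\sigma_i,\tau_i)\in[\![P_i]\!]_{\Lambda_i}$, $\zeta(\sigma_i)$, $\zeta(\tau_i)$ for $i=1,2$, and $\sigma_1\Uparrow\sigma_2$, it contains $(\sigma_1\cup\sigma_2,\tau_1\cup\tau_2)$. **Well-balanced pomsets and $U$.** A linear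 segment of a pomset is a chain of occurrences such that every occurrence outside it stands in the same order relation to all its elements; the SP components are the maximal linear segments. A pomset $P'$ over $\mathcal A_{TSO}$ is *well-balanced* if it is series-parallel (obtained from linear pomsets by sequential and parallel composition) and there is a bijection $\omega$ from its buffer writes to its global writes that maps the buffer writes of each SP component order-isomorphically onto the global writes of the same component, sends each $\bar x:=v$ to an occurrence of $x:=v$, and satisfies $b<_{P'}\omega(b)$. $U(P')$ is obtained from $P'$ by deleting the global writes and relabelling each $\bar x:=v$ as $x:=v$; its reads and skips are identified with those of $P'$, and the write that comes from a buffer write $b$ is identified with $\omega(b)$. **Theorem (soundness of $\mathcal T$).** For a pomset $P$ over $\mathcal A_{PO}$ let $$\mathcal T(P)=\bigcup_{P'\text{ well-balanced},\,U(P')=P}\{\Lambda{\restriction}_{\mathcal A_{PO}}\mid\Lambda\text{ a linearisation of }P',\ \exists(\sigma,\tau)\in[\![P']\!]_\Lambda:\ \zeta(\sigma)\wedge\zeta(\tau)\},$$ where $\Lambda{\restriction}_{\mathcal A_{PO}}$ is read as a list of the occurrences of $P$ through the above identification. Then for every program $p$, every finite $P\in\mathcal P_{PO}(p)$ and every $L\in\mathcal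 T(P)$, the list $L$ enumerates the occurrences of $P$ without repetition, and the total order it defines is TSO-consistent with $P$. -/

import Mathlib

namespace TSO

/-! ### Pomsets -/

/-- A (strict) partially ordered multiset over the label set `L`: a strict poset of action
occurrences together with a labelling. -/
structure Pom (L : Type*) where
  Occ : Type
  lt : Occ → Occ → Prop
  irrefl : ∀ a, ¬ lt a a
  trans : ∀ a b c, lt a b → lt b c → lt a c
  label : Occ → L

namespace Pom

variable {L : Type*}

/-- Isomorphisms of pomsets: label-preserving order isomorphisms. -/
structure Iso (P Q : Pom L) where
  toEquiv : P.Occ ≃ Q.Occ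
  lt_iff : ∀ a b, Q.lt (toEquiv a) (toEquiv b) ↔ P.lt a b
  label_eq : ∀ a, Q.label (toEquiv a) = P.label a

/-- The one-element pomset `{l}`. -/
def single (l : L) : Pom L where
  Occ := Unit
  lt := fun _ _ => False
  irrefl := fun _ h => h
  trans := fun _ _ _ h _ => h
  label := fun _ => l

/-- The sub-pomset on a set of occurrences, with the induced order. -/
def restrict (P : Pom L) (A : Set P.Occ) : Pom L where
  Occ := A
  lt := fun a b => P.lt a b
  irrefl := fun a => P.irrefl a
  trans := fun a b c => P.trans a b c
  label := fun a => P.label a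

/-- Parallel composition: disjoint union, without further ordering. -/
def par (P Q : Pom L) : Pom L where
  Occ := P.Occ ⊕ Q.Occ
  lt := Sum.LiftRel P.lt Q.lt
  irrefl := by
    rintro (a | a) h
    · exact P.irrefl a (by simpa using h)
    · exact Q.irrefl a (by simpa using h)
  trans := by
    rintro (a | a) (b | b) (c | c) h h' <;> simp at h h' ⊢
    · exact P.trans _ _ _ h h'
    · exact Q.trans _ _ _ h h'
  label := Sum.elim P.label Q.label

/-- Disjoint union with every occurrence of `P` below every occurrence of `Q`. -/
def ordSum (P Q : Pom L) : Pom L where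
  Occ := P.Occ ⊕ Q.Occ
  lt := Sum.Lex P.lt Q.lt
  irrefl := by
    rintro (a | a) h
    · exact P.irrefl a (by simpa using h)
    · exact Q.irrefl a (by simpa using h)
  trans := by
    rintro (a | a) (b | b) (c | c) h h' <;> simp at h h' ⊢
    · exact P.trans _ _ _ h h'
    · exact Q.trans _ _ _ h h'
  label := Sum.elim P.label Q.label

open Classical in
/-- Sequential composition `P;Q`; it is `P` when `P` is infinite. -/
noncomputable def seq (P Q : Pom L) : Pom L :=
  if Finite P.Occ then ordSum P Q else P

/-- The sequential composition `R 0; R 1; R 2; ⋯` of a sequence of pomsets. As in the binary case,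
whatever follows an infinite pomset is dropped. -/
def seqOmega (R : ℕ → Pom L) : Pom L where
  Occ := {x : Σ n, (R n).Occ // ∀ m < x.1, Finite (R m).Occ}
  lt := fun x y => Sigma.Lex (· < ·) (fun n => (R n).lt) x.1 y.1
  irrefl := by
    rintro ⟨⟨n, a⟩, _⟩ h
    rcases (Sigma.lex_iff.1 h) with h | ⟨_, h⟩
    · exact lt_irrefl _ h
    · exact (R n).irrefl a h
  trans := by
    rintro ⟨⟨n, a⟩, _⟩ ⟨⟨m, b⟩, _⟩ ⟨⟨k, c⟩, _⟩ h h'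
    simp only at h h' ⊢
    cases h with
    | left _ _ h =>
      cases h' with
      | left _ _ h' => exact Sigma.Lex.left _ _ (lt_trans h h')
      | right _ _ h' => exact Sigma.Lex.left _ _ h
    | right _ _ h =>
      cases h' with
      | left _ _ h' => exact Sigma.Lex.left _ _ h'
      | right _ _ h' => exact Sigma.Lex.right _ _ ((R _).trans _ _ _ h h')
  label := fun x => (R x.1.1).label x.1.2

/-- `Precedes Λ a b`: `a` occurs before `b` in the list `Λ`. For a list without repetitions this is
the strict total order on its elements that the list stands for. -/
def Precedes {α : Type*} (Λ : List α) (a b : α) : Prop := List.Sublist [a, b] Λ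

/-- `Λ` lists every element of `α` exactly once, so it stands for a total order on `α`. -/
def Enumerates {α : Type*} (Λ : List α) : Prop := Λ.Nodup ∧ ∀ a, a ∈ Λ

/-- The set of linearisations of a (finite) pomset. -/
def Lin (P : Pom L) : Set (List P.Occ) :=
  {Λ | Enumerates Λ ∧ ∀ a b, P.lt a b → Precedes Λ a b}

/-- Two distinct occurrences are incomparable. -/
def Incomp (P : Pom L) (a b : P.Occ) : Prop := a ≠ b ∧ ¬ P.lt a b ∧ ¬ P.lt b a

/-- `A` is a chain of `P`. -/
def IsLinear (P : Pom L) (A : Set P.Occ) : Prop :=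
  ∀ a ∈ A, ∀ b ∈ A, a ≠ b → P.lt a b ∨ P.lt b a

/-- `P` restricted to `A` is series-parallel: it is linear, or it is the sequential or the parallel
composition of series-parallel pomsets. (For an infinite first component a sequential composition
is that component.) -/
inductive IsSPOn (P : Pom L) : Set P.Occ → Prop
  | linear (A : Set P.Occ) : P.IsLinear A → IsSPOn P A
  | seq (A B : Set P.Occ) : IsSPOn P A → IsSPOn P B → A.Finite →
      (∀ a ∈ A, ∀ b ∈ B, P.lt a b) → IsSPOn P (A ∪ B)
  | par (A B : Set P.Occ) : IsSPOn P A → IsSPOn P B →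
      (∀ a ∈ A, ∀ b ∈ B, P.Incomp a b) → IsSPOn P (A ∪ B)

/-- A pomset is series-parallel. -/
def IsSP (P : Pom L) : Prop := P.IsSPOn Set.univ

/-- A linear segment: a chain all of whose elements are related in the same way to each occurrence
outside of it. -/
def IsLinearSegment (P : Pom L) (S : Set P.Occ) : Prop :=
  P.IsLinear S ∧ ∀ c ∉ S, ∀ a ∈ S, ∀ b ∈ S, (P.lt c a ↔ P.lt c b) ∧ (P.lt a c ↔ P.lt b c)

/-- The SP components of a pomset are its maximal linear segments. -/
def IsSPComponent (P : Pom L) (S : Set P.Occ) : Prop := Maximal P.IsLinearSegment S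

end Pom

open Pom

/-! ### Actions -/

/-- The program-order actions: global writes `x := v`, reads `x = v`, and the skip action `δ`. -/
inductive POAct (Loc V : Type*) where
  | write (x : Loc) (v : V)
  | read (x : Loc) (v : V)
  | skip

/-- The TSO actions: program-order actions and buffer writes `x̄ := v`. -/
inductive TSOAct (Loc V : Type*) where
  | po (l : POAct Loc V)
  | bufWrite (x : Loc) (v : V)

namespace TSOAct

variable {Loc V : Type*}

/-- Membership in the set of program-order actions. -/
def isPO : TSOAct Loc V → Bool
  | po _ => true
  | bufWrite _ _ => false

/-- Membership in the set of buffer writes. -/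
def isBuf : TSOAct Loc V → Bool
  | po _ => false
  | bufWrite _ _ => true

/-- Membership in the set of global writes. -/
def isGlob : TSOAct Loc V → Bool
  | po (.write _ _) => true
  | _ => false

/-- The relabelling that turns `x̄ := v` into `x := v` and fixes program-order actions. -/
def toPO : TSOAct Loc V → POAct Loc V
  | po l => l
  | bufWrite x v => .write x v

end TSOAct

/-! ### The programming language and its program orders -/

/-- Value expressions; the operators are arbitrary unary and binary operations on values. -/
inductive VExp (Loc V : Type*) where
  | const (v : V)
  | loc (x : Loc)
  | unop (op : V → V) (e : VExp Loc V)
  | binop (op : V → V → V) (e₁ e₂ : VExp Loc V)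

/-- Boolean expressions; the operators are arbitrary binary relations on values (`=`, `<`, …) and
arbitrary binary operations on truth values (`∨`, `∧`, …). -/
inductive BExp (Loc V : Type*) where
  | const (b : Bool)
  | neg (b : BExp Loc V)
  | cmp (op : V → V → Bool) (e₁ e₂ : VExp Loc V)
  | binop (op : Bool → Bool → Bool) (b₁ b₂ : BExp Loc V)

/-- Commands. A program is a command. -/
inductive Cmd (Loc V : Type*) where
  | skip
  | assign (x : Loc) (e : VExp Loc V)
  | seq (c₁ c₂ : Cmd Loc V)
  | par (c₁ c₂ : Cmd Loc V)
  | ite (b : BExp Loc V) (c₁ c₂ : Cmd Loc V)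
  | while (b : BExp Loc V) (c : Cmd Loc V)

section Denotation

variable {Loc V : Type*}

/-- Program orders of a value expression, with the resulting values. -/
def VExp.po : VExp Loc V → Set (Pom (POAct Loc V) × V)
  | .const v => {(Pom.single .skip, v)}
  | .loc x => {q | ∃ v, q = (Pom.single (.read x v), v)}
  | .unop op e => {q | ∃ P v, (P, v) ∈ e.po ∧ q = (P, op v)}
  | .binop op e₁ e₂ => {q | ∃ P₁ v₁ P₂ v₂, (P₁, v₁) ∈ e₁.po ∧ (P₂, v₂) ∈ e₂.po ∧
      q = (Pom.par P₁ P₂, op v₁ v₂)}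

/-- Program orders of a boolean expression, with the resulting truth values. -/
def BExp.po : BExp Loc V → Set (Pom (POAct Loc V) × Bool)
  | .const b => {(Pom.single .skip, b)}
  | .neg b => {q | ∃ P t, (P, t) ∈ b.po ∧ q = (P, !t)}
  | .cmp op e₁ e₂ => {q | ∃ P₁ v₁ P₂ v₂, (P₁, v₁) ∈ e₁.po ∧ (P₂, v₂) ∈ e₂.po ∧
      q = (Pom.par P₁ P₂, op v₁ v₂)}
  | .binop op b₁ b₂ => {q | ∃ P₁ t₁ P₂ t₂, (P₁, t₁) ∈ b₁.po ∧ (P₂, t₂) ∈ b₂.po ∧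
      q = (Pom.par P₁ P₂, op t₁ t₂)}

/-- The pomsets of `b` that yield the truth value `t`. -/
def BExp.poVal (b : BExp Loc V) (t : Bool) : Set (Pom (POAct Loc V)) := {P | (P, t) ∈ b.po}

/-- Sequential composition, lifted to sets of pomsets. -/
def seqSet {L : Type*} (S T : Set (Pom L)) : Set (Pom L) :=
  {R | ∃ P ∈ S, ∃ Q ∈ T, R = Pom.seq P Q}

/-- Parallel composition, lifted to sets of pomsets. -/
def parSet {L : Type*} (S T : Set (Pom L)) : Set (Pom L) :=
  {R | ∃ P ∈ S, ∃ Q ∈ T, R = Pom.par P Q}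

/-- The `n`-fold unrolling of a loop, from the pomsets `T` and `F` of the guard being true and false
and the pomsets `C` of the body. -/
def loopIter {L : Type*} (T F C : Set (Pom L)) : ℕ → Set (Pom L)
  | 0 => F
  | n + 1 => seqSet T (seqSet C (loopIter T F C n))

/-- The infinite unrollings of a loop. -/
def loopOmega {L : Type*} (T C : Set (Pom L)) : Set (Pom L) :=
  {R | ∃ B D : ℕ → Pom L, (∀ n, B n ∈ T) ∧ (∀ n, D n ∈ C) ∧ R = seqOmega fun n => Pom.seq (B n) (D n)}

/-- The concrete program orders that the semantic clauses assign to a command. -/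
def Cmd.po : Cmd Loc V → Set (Pom (POAct Loc V))
  | .skip => {Pom.single .skip}
  | .assign x e => {R | ∃ P v, (P, v) ∈ e.po ∧ R = Pom.seq P (Pom.single (.write x v))}
  | .seq c₁ c₂ => seqSet c₁.po c₂.po
  | .par c₁ c₂ => parSet c₁.po c₂.po
  | .ite b c₁ c₂ => seqSet (b.poVal true) c₁.po ∪ seqSet (b.poVal false) c₂.po
  | .while b c => (⋃ n, loopIter (b.poVal true) (b.poVal false) c.po n) ∪
      loopOmega (b.poVal true) c.po

/-- The identification of program orders up to skip actions: the same non-empty pomset (up to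
isomorphism) results from deleting finitely many `δ` from `P` and finitely many `δ` from `Q`. -/
def SkipEquiv (P Q : Pom (POAct Loc V)) : Prop :=
  ∃ (A : Set P.Occ) (B : Set Q.Occ), A.Nonempty ∧
    Aᶜ.Finite ∧ (∀ a ∈ Aᶜ, P.label a = .skip) ∧
    Bᶜ.Finite ∧ (∀ b ∈ Bᶜ, Q.label b = .skip) ∧
    Nonempty (Iso (P.restrict A) (Q.restrict B))

/-- The set of program-order pomsets of a program, containing every representative under
isomorphism and under the identification up to skip actions. -/
def PPO (p : Cmd Loc V) : Set (Pom (POAct Loc V)) := {P | ∃ Q ∈ p.po, SkipEquiv P Q}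

end Denotation

/-! ### States -/

/-- Finite partial functions. -/
@[ext] structure FinPart (α β : Type*) where
  toFun : α → Option β
  finite_dom : {a | toFun a ≠ none}.Finite

namespace FinPart

variable {α β : Type*}

/-- The domain of a finite partial function. -/
def dom (f : FinPart α β) : Set α := {a | f.toFun a ≠ none}

/-- The nowhere defined function. -/
def empty : FinPart α β := ⟨fun _ => none, by simp⟩

open Classical in
/-- The function with graph `{(a, b)}`. -/
noncomputable def single (a : α) (b : β) : FinPart α β :=
  ⟨fun a' => if a' = a then some b else none, (Set.finite_singleton a).subset (by
    intro a' h; by_contra h'; simp_all)⟩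

/-- The union of graphs. It is used for consistent arguments only; otherwise `f` prevails. -/
def union (f g : FinPart α β) : FinPart α β :=
  ⟨fun a => (f.toFun a).or (g.toFun a), (f.finite_dom.union g.finite_dom).subset (by
    intro a h; by_contra h'; simp_all)⟩

open Classical in
/-- `f ∖ dom g`: the restriction of `f` to the complement of the domain of `g`. -/
noncomputable def diff {γ : Type*} (f : FinPart α β) (g : FinPart α γ) : FinPart α β :=
  ⟨fun a => if a ∈ g.dom then none else f.toFun a, f.finite_dom.subset (by
    intro a h; by_contra h'; simp_all)⟩

/-- `[f | g] = (f ∖ dom g) ∪ g`: the update of `f` by `g`. -/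
noncomputable def update (f g : FinPart α β) : FinPart α β := (f.diff g).union g

/-- `f` and `g` agree on the intersection of their domains. -/
def Consistent (f g : FinPart α β) : Prop := ∀ a ∈ f.dom ∩ g.dom, f.toFun a = g.toFun a

end FinPart

/-! ### Axiomatic TSO -/

section Axioms

variable {Loc V : Type*}

/-- `l` is a global write action. -/
def POAct.IsWrite (l : POAct Loc V) : Prop := ∃ x v, l = .write x v

/-- `l` is a global write to `x`. -/
def POAct.IsWriteTo (l : POAct Loc V) (x : Loc) : Prop := ∃ v, l = .write x v

/-- `l` is a read action. -/
def POAct.IsRead (l : POAct Loc V) : Prop := ∃ x v, l = .read x v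

/-- The lower closure of `s` under the strict order `lt`. -/
def lowerClosure {α : Type*} (lt : α → α → Prop) (s : α) : Set α := {s' | lt s' s} ∪ {s}

/-- `w` is maximal in `S` under the strict order `lt`. -/
def IsMaxIn {α : Type*} (lt : α → α → Prop) (S : Set α) (w : α) : Prop :=
  w ∈ S ∧ ∀ w' ∈ S, ¬ lt w w'

/-- The writes to `x` in the lower closure of `r` under `lt`. -/
def writesBelow (P : Pom (POAct Loc V)) (lt : P.Occ → P.Occ → Prop) (x : Loc) (r : P.Occ) :
    Set P.Occ :=
  {w | (P.label w).IsWriteTo x} ∩ lowerClosure lt r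

/-- The strict partial order `T` on the occurrences of `P` is TSO-consistent with `P` from the
initial state `σ`. -/
structure TSOConsistentFrom (σ : FinPart Loc V) (P : Pom (POAct Loc V))
    (T : P.Occ → P.Occ → Prop) : Prop where
  strict : IsStrictOrder P.Occ T
  /-- O -/
  ordering : ∀ w w', (P.label w).IsWrite → (P.label w').IsWrite → w ≠ w' → T w w' ∨ T w' w
  /-- V -/
  value : ∀ r x v, P.label r = .read x v →
    (∃ w v', P.label w = .write x v' ∧ IsMaxIn T (writesBelow P T x r) w ∧
      writesBelow P P.lt x r ⊆ lowerClosure T w ∧ v = v') ∨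
    (∃ w v', P.label w = .write x v' ∧ IsMaxIn P.lt (writesBelow P P.lt x r) w ∧
      T r w ∧ v = v') ∨
    (writesBelow P T x r = ∅ ∧ writesBelow P P.lt x r = ∅ ∧ σ.toFun x = some v)
  /-- L -/
  loadOp : ∀ r a, (P.label r).IsRead → P.lt r a → T r a
  /-- S -/
  storeStore : ∀ w w', (P.label w).IsWrite → (P.label w').IsWrite → P.lt w w' → T w w'
  /-- F -/
  fork : ∀ a₁ a₂ a₃, P.lt a₁ a₂ → P.lt a₁ a₃ → P.Incomp a₂ a₃ → T a₁ a₂ ∧ T a₁ a₃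
  /-- J -/
  join : ∀ a₁ a₂ a₃, P.lt a₁ a₃ → P.lt a₂ a₃ → P.Incomp a₁ a₂ → T a₁ a₃ ∧ T a₂ a₃

/-- `T` is TSO-consistent with `P` (from some initial state). -/
def TSOConsistent (P : Pom (POAct Loc V)) (T : P.Occ → P.Occ → Prop) : Prop :=
  ∃ σ, TSOConsistentFrom σ P T

/-- A function that assigns sets of lists (total orders on the occurrences of `P`) to pomsets `P` is
sound if, for every program `p` and every finite `P` among its program orders, it yields only
TSO-consistent total orders. -/
def Sound (f : (P : Pom (POAct Loc V)) → Set (List P.Occ)) : Prop :=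
  ∀ (p : Cmd Loc V) (P : Pom (POAct Loc V)), P ∈ PPO p → Finite P.Occ →
    ∀ L ∈ f P, Enumerates L ∧ TSOConsistent P (Precedes L)

end Axioms

/-! ### Footprints -/

/-- `(v, n) ≈ (v', m)` iff `n = m`, and `v = v'` or `n = 0`. -/
def bufSetoid (V : Type*) : Setoid (V × ℕ) where
  r a b := a.2 = b.2 ∧ (a.1 = b.1 ∨ a.2 = 0)
  iseqv := by
    refine ⟨fun a => ⟨rfl, Or.inl rfl⟩, ?_, ?_⟩
    · rintro a b ⟨h, h' | h'⟩
      · exact ⟨h.symm, Or.inl h'.symm⟩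
      · exact ⟨h.symm, Or.inr (h ▸ h')⟩
    · rintro a b c ⟨h₁, h₂⟩ ⟨h₃, h₄⟩
      refine ⟨h₁.trans h₃, ?_⟩
      rcases h₂ with h₂ | h₂
      · rcases h₄ with h₄ | h₄
        · exact Or.inl (h₂.trans h₄)
        · exact Or.inr (h₁.trans h₄)
      · exact Or.inr h₂

/-- Buffer values `(V × ℕ)/≈`. -/
def BufVal (V : Type*) : Type _ := Quotient (bufSetoid V)

/-- `v_n`: the most recent of `n` buffered writes has value `v`. -/
def bufVal {V : Type*} (v : V) (n : ℕ) : BufVal V := Quotient.mk (bufSetoid V) (v, n)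

/-- Buffered states: a finite partial function on buffer locations (indexed by the locations
themselves) and one on locations. -/
@[ext] structure BState (Loc V : Type*) where
  buf : FinPart Loc (BufVal V)
  mem : FinPart Loc V

namespace BState

variable {Loc V : Type*}

/-- The empty state `[]`. -/
def empty : BState Loc V := ⟨.empty, .empty⟩

/-- Union of (consistent) states. -/
def union (σ τ : BState Loc V) : BState Loc V := ⟨σ.buf.union τ.buf, σ.mem.union τ.mem⟩

/-- `σ ∖ dom τ`. -/
noncomputable def diff (σ τ : BState Loc V) : BState Loc V := ⟨σ.buf.diff τ.buf, σ.mem.diff τ.mem⟩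

/-- `[σ | τ]`. -/
noncomputable def update (σ τ : BState Loc V) : BState Loc V :=
  ⟨σ.buf.update τ.buf, σ.mem.update τ.mem⟩

/-- Consistency of states. -/
def Consistent (σ τ : BState Loc V) : Prop := σ.buf.Consistent τ.buf ∧ σ.mem.Consistent τ.mem

/-- `ζ(σ)`: the state has an empty buffer. -/
def EmptyBuf (σ : BState Loc V) : Prop := ∀ x ∈ σ.buf.dom, ∃ v, σ.buf.toFun x = some (bufVal v 0)

end BState

section Footprint

variable {Loc V : Type*}

/-- Sequential composition of sets of footsteps. -/
def seqFoot (S₁ S₂ : Set (BState Loc V × BState Loc V)) : Set (BState Loc V × BState Loc V) :=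
  {s | ∃ σ₁ τ₁ σ₂ τ₂, (σ₁, τ₁) ∈ S₁ ∧ (σ₂, τ₂) ∈ S₂ ∧ (σ₁.update τ₁).Consistent σ₂ ∧
    s = (σ₁.union (σ₂.diff τ₁), τ₁.update τ₂)}

/-- The footprint of a single action. -/
def actFoot : TSOAct Loc V → Set (BState Loc V × BState Loc V)
  | .po (.read x v) =>
      {(⟨.single x (bufVal v 0), .single x v⟩, .empty)} ∪
      {s | ∃ n : ℕ, s = (⟨.single x (bufVal v (n + 1)), .empty⟩, .empty)}
  | .bufWrite x v =>
      {s | ∃ (v' : V) (n : ℕ), s =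
        (⟨.single x (bufVal v' n), .empty⟩, ⟨.single x (bufVal v (n + 1)), .empty⟩)}
  | .po (.write x v) =>
      {s | ∃ (v' v'' : V) (n : ℕ), s =
        (⟨.single x (bufVal v'' (n + 1)), .single x v'⟩, ⟨.single x (bufVal v'' n), .single x v⟩)}
  | .po .skip => {(.empty, .empty)}

/-- The footprint of a list of global writes (location, value) performed by other threads. -/
def envFoot : List (Loc × V) → Set (BState Loc V × BState Loc V)
  | [] => {(.empty, .empty)}
  | (x, v) :: E =>
      seqFoot {s | ∃ v' : V, s = (⟨.empty, .single x v'⟩, ⟨.empty, .single x v⟩)} (envFoot E)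

/-- An environment list: its entries are occurrences of the pomset `P` (`Sum.inl`) or foreign global
writes (`Sum.inr`). -/
abbrev Env (P : Pom (TSOAct Loc V)) : Type _ := List (P.Occ ⊕ (Loc × V))

/-- `Λ` is a global-write environment for the restriction of `P` to `A`: a linearisation of that
pomset interspersed with foreign global writes. -/
def IsEnv (P : Pom (TSOAct Loc V)) (A : Set P.Occ) (Λ : Env P) : Prop :=
  (Λ.filterMap Sum.getLeft?).Nodup ∧
  (∀ a, a ∈ Λ.filterMap Sum.getLeft? ↔ a ∈ A) ∧
  ∀ a ∈ A, ∀ b ∈ A, P.lt a b → Precedes (Λ.filterMap Sum.getLeft?) a b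

open Classical in
/-- How a component with set of occurrences `A` sees an entry of the environment of a parallel
composition: its own occurrences and foreign writes are kept, the global writes of the other
component become foreign writes, and the other actions of the other component are deleted. -/
noncomputable def viewEntry (P : Pom (TSOAct Loc V)) (A : Set P.Occ) :
    P.Occ ⊕ (Loc × V) → Option (P.Occ ⊕ (Loc × V))
  | .inr w => some (.inr w)
  | .inl a => if a ∈ A then some (.inl a) else
      match P.label a with
      | .po (.write x v) => some (.inr (x, v))
      | _ => none

/-- The restriction of the environment `Λ` to the component `A` of a parallel composition. -/
noncomputable def view (P : Pom (TSOAct Loc V)) (A : Set P.Occ) (Λ : Env P) : Env P :=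
  Λ.filterMap (viewEntry P A)

/-- `FootOn P A Λ σ τ`: `(σ, τ)` is in the footprint of the restriction of `P` to `A` under the
global-write environment `Λ`. -/
inductive FootOn (P : Pom (TSOAct Loc V)) :
    Set P.Occ → Env P → BState Loc V → BState Loc V → Prop
  | act (a : P.Occ) (E₁ E₂ : List (Loc × V)) (σ τ : BState Loc V) :
      (σ, τ) ∈ seqFoot (seqFoot (envFoot E₁) (actFoot (P.label a))) (envFoot E₂) →
      FootOn P {a} (E₁.map Sum.inr ++ [Sum.inl a] ++ E₂.map Sum.inr) σ τ
  | seq (A₁ A₂ : Set P.Occ) (Λ₁ Λ₂ : Env P) (σ₁ τ₁ σ₂ τ₂ : BState Loc V) :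
      (∀ a ∈ A₁, ∀ b ∈ A₂, P.lt a b) →
      IsEnv P A₁ Λ₁ → IsEnv P A₂ Λ₂ →
      FootOn P A₁ Λ₁ σ₁ τ₁ → FootOn P A₂ Λ₂ σ₂ τ₂ →
      (σ₁.update τ₁).Consistent σ₂ →
      FootOn P (A₁ ∪ A₂) (Λ₁ ++ Λ₂) (σ₁.union (σ₂.diff τ₁)) (τ₁.update τ₂)
  | par (A₁ A₂ : Set P.Occ) (Λ : Env P) (σ₁ τ₁ σ₂ τ₂ : BState Loc V) :
      (∀ a ∈ A₁, ∀ b ∈ A₂, P.Incomp a b) →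
      IsEnv P (A₁ ∪ A₂) Λ →
      FootOn P A₁ (view P A₁ Λ) σ₁ τ₁ → FootOn P A₂ (view P A₂ Λ) σ₂ τ₂ →
      σ₁.EmptyBuf → τ₁.EmptyBuf → σ₂.EmptyBuf → τ₂.EmptyBuf →
      σ₁.Consistent σ₂ →
      FootOn P (A₁ ∪ A₂) Λ (σ₁.union σ₂) (τ₁.union τ₂)

/-- The footsteps with empty initial and final buffers in the footprint of `P` under a linearisation
`Λ` of `P` (an environment without foreign writes). -/
def zfoot (P : Pom (TSOAct Loc V)) (Λ : List P.Occ) : Set (BState Loc V × BState Loc V) :=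
  {s | FootOn P Set.univ (Λ.map Sum.inl) s.1 s.2 ∧ s.1.EmptyBuf ∧ s.2.EmptyBuf}

end Footprint

/-! ### Well-balanced pomsets, underlying program orders, and the function 𝒯 -/

section Soundness

variable {Loc V : Type*}

/-- The buffer-write occurrences of `P`. -/
abbrev BufOcc (P : Pom (TSOAct Loc V)) : Type := {a : P.Occ // (P.label a).isBuf = true}

/-- The global-write occurrences of `P`. -/
abbrev GlobOcc (P : Pom (TSOAct Loc V)) : Type := {a : P.Occ // (P.label a).isGlob = true}

/-- `ω` maps the buffer writes of each SP component order-isomorphically onto the global writes of the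
same component, preserves location and value, and every buffer write is below its image. -/
structure IsBalancing (P : Pom (TSOAct Loc V)) (ω : BufOcc P ≃ GlobOcc P) : Prop where
  component : ∀ b, ∃ S, P.IsSPComponent S ∧ b.1 ∈ S ∧ (ω b).1 ∈ S
  order : ∀ S, P.IsSPComponent S → ∀ b b', b.1 ∈ S → b'.1 ∈ S →
    (P.lt b.1 b'.1 ↔ P.lt (ω b).1 (ω b').1)
  label : ∀ b, (P.label (ω b).1).toPO = (P.label b.1).toPO
  below : ∀ b, P.lt b.1 (ω b).1

/-- The underlying program order: delete the global writes and relabel `x̄ := v` as `x := v`. -/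
def U (P : Pom (TSOAct Loc V)) : Pom (POAct Loc V) where
  Occ := {a : P.Occ // ¬ (P.label a).isGlob = true}
  lt := fun a b => P.lt a b
  irrefl := fun a => P.irrefl a
  trans := fun a b c => P.trans a b c
  label := fun a => (P.label a).toPO

/-- The occurrence of `P` with which an occurrence of `U P` is identified: reads and skips with
themselves, and the write that stems from the buffer write `b` with the global write `ω b`. -/
def rep (P : Pom (TSOAct Loc V)) (ω : BufOcc P ≃ GlobOcc P) (u : (U P).Occ) : P.Occ :=
  if h : (P.label u.1).isBuf = true then (ω ⟨u.1, h⟩).1 else u.1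

/-- The function `𝒯`. A list `L` of the occurrences of `P` belongs to `𝒯 P` if there are a
well-balanced (that is, series-parallel and with a balancing `ω`) TSO pomset `P'` with `U P' = P` (up
to the isomorphism `φ`) and a linearisation `Λ` of `P'` with a footstep with empty buffers, such that
`L` is the restriction of `Λ` to program-order actions under the identification of the occurrences
of `P` with the program-order occurrences of `P'`. -/
def 𝒯 (P : Pom (POAct Loc V)) : Set (List P.Occ) :=
  {L | ∃ (P' : Pom (TSOAct Loc V)) (ω : BufOcc P' ≃ GlobOcc P') (φ : Iso (U P') P)
      (Λ : List P'.Occ),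
    P'.IsSP ∧ IsBalancing P' ω ∧ Λ ∈ P'.Lin ∧ (zfoot P' Λ).Nonempty ∧
    L.map (fun p => rep P' ω (φ.toEquiv.symm p)) = Λ.filter (fun a => (P'.label a).isPO)}

end Soundness

end TSO

/-!
A footstep `(σ, τ)` acts on total states: it applies to those that extend `σ`, and it overwrites
them by `τ`. In this reading `◁` is the composition of actions, so over any stretch of the execution
the number of buffered writes to `x` grows by the number of buffer writes to `x` minus the number of
global writes to `x`, and the head of a non-empty buffer is the last buffer write. Parallel
components start with empty buffers. Hence a read that finds an empty buffer has as many global as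
buffer writes to `x` below it; a balancing injects the former into the latter, so every buffer write
below the read is matched by a global write below the read, and the read sees the memory (clauses
(a) and (c)). A read that finds a non-empty buffer takes its value from the last buffer write `b`
below it, and by counting again the global write matching `b` comes later (clause (b)). Clauses (F)
and (J) hold because `b` and `ω b` lie in one linear segment, and whatever lies above `b` in a fork
or join at `b` is outside that segment, hence also above `ω b`.
-/

namespace TSO

open Pom

/-! ### Finite partial functions as actions on total functions -/

namespace FinPart

variable {α β : Type*}

@[simp] theorem toFun_empty (a : α) : (empty : FinPart α β).toFun a = none := rfl

open Classical in
@[simp] theorem toFun_single (a : α) (b : β) (a' : α) :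
    (single a b).toFun a' = if a' = a then some b else none := rfl

@[simp] theorem toFun_union (f g : FinPart α β) (a : α) :
    (f.union g).toFun a = (f.toFun a).or (g.toFun a) := rfl

open Classical in
@[simp] theorem toFun_diff {γ : Type*} (f : FinPart α β) (g : FinPart α γ) (a : α) :
    (f.diff g).toFun a = if g.toFun a = none then f.toFun a else none := by
  cases h : g.toFun a <;> simp [diff, dom, h]

@[simp] theorem toFun_update (f g : FinPart α β) (a : α) :
    (f.update g).toFun a = (g.toFun a).or (f.toFun a) := by
  cases h : g.toFun a <;> simp [update, h]

@[simp] theorem empty_union (f : FinPart α β) : empty.union f = f :=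
  FinPart.ext (funext fun a => by simp)

@[simp] theorem union_empty (f : FinPart α β) : f.union empty = f :=
  FinPart.ext (funext fun a => by simp)

@[simp] theorem diff_empty {γ : Type*} (f : FinPart α β) :
    f.diff (empty : FinPart α γ) = f := FinPart.ext (funext fun a => by simp)

@[simp] theorem empty_diff {γ : Type*} (g : FinPart α γ) :
    (empty : FinPart α β).diff g = empty := FinPart.ext (funext fun a => by simp)

@[simp] theorem empty_update (f : FinPart α β) : empty.update f = f :=
  FinPart.ext (funext fun a => by simp)

@[simp] theorem update_empty (f : FinPart α β) : f.update empty = f :=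
  FinPart.ext (funext fun a => by simp)

theorem Consistent.eq {f g : FinPart α β} (h : f.Consistent g) {a : α} {p q : β}
    (hp : f.toFun a = some p) (hq : g.toFun a = some q) : p = q := by
  simpa [hp, hq] using h a (by simp [dom, hp, hq])

/-- The total function `g` extends the partial function `f`. -/
def AgreesWith (f : FinPart α β) (g : α → β) : Prop := ∀ a b, f.toFun a = some b → g a = b

/-- The total function `g` overwritten by the partial function `f`. -/
def override (f : FinPart α β) (g : α → β) : α → β := fun a => (f.toFun a).getD (g a)

theorem override_of_eq_some {f : FinPart α β} {a : α} {b : β} (h : f.toFun a = some b)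
    (g : α → β) : f.override g a = b := by simp [override, h]

theorem override_of_eq_none {f : FinPart α β} {a : α} (h : f.toFun a = none) (g : α → β) :
    f.override g a = g a := by simp [override, h]

theorem agreesWith_override (f : FinPart α β) (g : α → β) : f.AgreesWith (f.override g) :=
  fun _ _ h => override_of_eq_some h g

theorem override_update (f f' : FinPart α β) (g : α → β) :
    (f.update f').override g = f'.override (f.override g) := by
  funext a
  cases h : f'.toFun a <;> simp [override, h]

theorem Consistent.toFun_seq_eq_some {σ₁ τ₁ σ₂ : FinPart α β} (hc : (σ₁.update τ₁).Consistent σ₂)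
    {a : α} {b : β} (h : σ₂.toFun a = some b) :
    ((σ₁.union (σ₂.diff τ₁)).update τ₁).toFun a = some b := by
  have hb : ∀ p, (τ₁.toFun a).or (σ₁.toFun a) = some p → p = b := fun p hp =>
    hc.eq (by rw [toFun_update, hp]) h
  cases ht : τ₁.toFun a <;> cases hs : σ₁.toFun a <;> simp_all

theorem Consistent.agreesWith_of_seq {σ₁ τ₁ σ₂ : FinPart α β} (hc : (σ₁.update τ₁).Consistent σ₂)
    {g : α → β} (hg : (σ₁.union (σ₂.diff τ₁)).AgreesWith g) :
    σ₁.AgreesWith g ∧ σ₂.AgreesWith (τ₁.override g) := by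
  refine ⟨fun a b h => hg a b (by simp [h]), fun a b h => ?_⟩
  have h' := hc.toFun_seq_eq_some h
  rw [toFun_update] at h'
  cases ht : τ₁.toFun a with
  | none => rw [override_of_eq_none ht]; exact hg a b (by simpa [ht] using h')
  | some p => rw [override_of_eq_some ht]; simpa [ht] using h'

theorem Consistent.agreesWith_of_union {σ₁ σ₂ : FinPart α β} (hc : σ₁.Consistent σ₂) {g : α → β}
    (hg : (σ₁.union σ₂).AgreesWith g) : σ₁.AgreesWith g ∧ σ₂.AgreesWith g := by
  refine ⟨fun a b h => hg a b (by simp [h]), fun a b h => ?_⟩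
  cases hs : σ₁.toFun a with
  | none => exact hg a b (by simp [hs, h])
  | some p => exact (hg a p (by simp [hs])).trans (hc.eq hs h)

end FinPart

/-! ### Buffer runs -/

namespace BufVal

variable {V : Type*}

/-- The number of buffered writes. -/
def count (β : BufVal V) : ℕ := Quotient.lift (s := bufSetoid V) Prod.snd (fun _ _ h => h.1) β

/-- The buffer is non-empty and its most recent write has value `v`. -/
def HasTop (β : BufVal V) (v : V) : Prop := ∃ n, β = bufVal v (n + 1)

@[simp] theorem count_bufVal (v : V) (n : ℕ) : (bufVal v n).count = n := rfl

@[simp] theorem hasTop_bufVal {v w : V} {n : ℕ} : (bufVal v n).HasTop w ↔ n ≠ 0 ∧ v = w := by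
  constructor
  · rintro ⟨m, h⟩
    obtain ⟨hn, hv⟩ : n = m + 1 ∧ (v = w ∨ n = 0) := Quotient.exact (s := bufSetoid V) h
    exact ⟨by omega, hv.resolve_right (by omega)⟩
  · rintro ⟨hn, rfl⟩
    exact ⟨n - 1, by rw [Nat.sub_add_cancel (Nat.one_le_iff_ne_zero.2 hn)]⟩

theorem HasTop.count_ne_zero {β : BufVal V} {v : V} (h : β.HasTop v) : β.count ≠ 0 := by
  obtain ⟨n, rfl⟩ := h
  exact Nat.succ_ne_zero n

end BufVal

section BufRun

variable {L : Type*} {Q : Pom L}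

theorem Pom.asymm {a b : Q.Occ} (h : Q.lt a b) : ¬ Q.lt b a :=
  fun h' => Q.irrefl a (Q.trans a b a h h')

theorem Pom.Incomp.symm {a b : Q.Occ} (h : Q.Incomp a b) : Q.Incomp b a :=
  ⟨h.1.symm, h.2.2, h.2.1⟩

theorem disjoint_of_lt {A B : Set Q.Occ} (h : ∀ a ∈ A, ∀ b ∈ B, Q.lt a b) : Disjoint A B :=
  Set.disjoint_left.2 fun a ha hb => Q.irrefl a (h a ha a hb)

theorem disjoint_of_incomp {A B : Set Q.Occ} (h : ∀ a ∈ A, ∀ b ∈ B, Q.Incomp a b) :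
    Disjoint A B :=
  Set.disjoint_left.2 fun a ha hb => (h a ha a hb).1 rfl

variable {Loc V : Type*} (P : Pom (TSOAct Loc V)) (x : Loc)

/-- The occurrence `a` is a buffer write to `x`. -/
def BufTo (a : P.Occ) : Prop := ∃ v, P.label a = .bufWrite x v

/-- The occurrence `a` is a global write to `x`. -/
def GlobTo (a : P.Occ) : Prop := ∃ v, P.label a = .po (.write x v)

/-- The number of buffer writes to `x` in `A`. -/
noncomputable def bufs (A : Set P.Occ) : ℕ := (A ∩ {a | BufTo P x a}).ncard

/-- The number of global writes to `x` in `A`. -/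
noncomputable def globs (A : Set P.Occ) : ℕ := (A ∩ {a | GlobTo P x a}).ncard

/-- `A` contains a last buffer write to `x`, and this write has value `v`. -/
def LastBuf (A : Set P.Occ) (v : V) : Prop :=
  ∃ b ∈ A, P.label b = .bufWrite x v ∧ ∀ b' ∈ A, BufTo P x b' → b' = b ∨ P.lt b' b

/-- The occurrences in `A` can turn the buffer value `β` of `x` into `β'`. Only the length of the
buffer and its most recent entry are tracked, so the order of execution matters for the last buffer
write alone. -/
structure BufRun (A : Set P.Occ) (β β' : BufVal V) : Prop where
  count : β.count + bufs P x A = β'.count + globs P x A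
  top : ∀ v, β'.HasTop v → LastBuf P x A v ∨ bufs P x A = 0 ∧ β.HasTop v

variable {P x}

theorem bufs_union [Finite P.Occ] {A B : Set P.Occ} (h : Disjoint A B) :
    bufs P x (A ∪ B) = bufs P x A + bufs P x B := by
  rw [bufs, Set.union_inter_distrib_right, Set.ncard_union_eq
    (h.mono Set.inter_subset_left Set.inter_subset_left)]
  rfl

theorem globs_union [Finite P.Occ] {A B : Set P.Occ} (h : Disjoint A B) :
    globs P x (A ∪ B) = globs P x A + globs P x B := by
  rw [globs, Set.union_inter_distrib_right, Set.ncard_union_eq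
    (h.mono Set.inter_subset_left Set.inter_subset_left)]
  rfl

theorem bufs_eq_zero [Finite P.Occ] {A : Set P.Occ} :
    bufs P x A = 0 ↔ ∀ a ∈ A, ¬ BufTo P x a := by
  rw [bufs, Set.ncard_eq_zero, Set.eq_empty_iff_forall_notMem]
  simp

theorem BufRun.empty (β : BufVal V) : BufRun P x ∅ β β :=
  ⟨by simp [bufs, globs], fun _ h => .inr ⟨by simp [bufs], h⟩⟩

theorem BufRun.trans [Finite P.Occ] {A₁ A₂ : Set P.Occ} (hlt : ∀ a ∈ A₁, ∀ b ∈ A₂, P.lt a b)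
    {β₀ β₁ β₂ : BufVal V} (h₁ : BufRun P x A₁ β₀ β₁) (h₂ : BufRun P x A₂ β₁ β₂) :
    BufRun P x (A₁ ∪ A₂) β₀ β₂ := by
  have hd := disjoint_of_lt hlt
  have c₁ := h₁.count
  have c₂ := h₂.count
  refine ⟨by rw [bufs_union hd, globs_union hd]; omega, fun v hv => ?_⟩
  rcases h₂.top v hv with ⟨b, hb, hl, hmax⟩ | ⟨h0₂, hv₁⟩
  · refine .inl ⟨b, .inr hb, hl, ?_⟩
    rintro b' (hb' | hb') hto
    exacts [.inr (hlt _ hb' _ hb), hmax b' hb' hto]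
  · rcases h₁.top v hv₁ with ⟨b, hb, hl, hmax⟩ | ⟨h0₁, hv₀⟩
    · refine .inl ⟨b, .inl hb, hl, ?_⟩
      rintro b' (hb' | hb') hto
      exacts [hmax b' hb' hto, absurd hto (bufs_eq_zero.1 h0₂ b' hb')]
    · exact .inr ⟨by rw [bufs_union hd, h0₁, h0₂], hv₀⟩

end BufRun

/-! ### Modules and balancings -/

section Modules

variable {L : Type*} {Q : Pom L} {A B : Set Q.Occ}

/-- A module of a pomset: every occurrence outside of `A` is related in the same way to all elements
of `A`. -/
def IsModule (Q : Pom L) (A : Set Q.Occ) : Prop :=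
  ∀ c ∉ A, ∀ a ∈ A, ∀ b ∈ A, (Q.lt c a ↔ Q.lt c b) ∧ (Q.lt a c ↔ Q.lt b c)

/-- `A` is a union of SP components. -/
def ComponentClosed (Q : Pom L) (A : Set Q.Occ) : Prop :=
  ∀ S, Q.IsSPComponent S → ∀ a ∈ S, a ∈ A → S ⊆ A

theorem isModule_univ : IsModule Q Set.univ := fun c hc => absurd (Set.mem_univ c) hc

theorem componentClosed_univ : ComponentClosed Q Set.univ := fun _ _ _ _ _ => Set.subset_univ _

theorem IsModule.left_of_lt (h : IsModule Q (A ∪ B)) (hlt : ∀ a ∈ A, ∀ b ∈ B, Q.lt a b) :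
    IsModule Q A := by
  intro c hc a ha a' ha'
  by_cases hcB : c ∈ B
  · have h₁ := hlt a ha c hcB
    have h₂ := hlt a' ha' c hcB
    exact ⟨iff_of_false (Pom.asymm h₁) (Pom.asymm h₂), iff_of_true h₁ h₂⟩
  · exact h c (by simp [hc, hcB]) a (.inl ha) a' (.inl ha')

theorem IsModule.right_of_lt (h : IsModule Q (A ∪ B)) (hlt : ∀ a ∈ A, ∀ b ∈ B, Q.lt a b) :
    IsModule Q B := by
  intro c hc b hb b' hb'
  by_cases hcA : c ∈ A
  · have h₁ := hlt c hcA b hb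
    have h₂ := hlt c hcA b' hb'
    exact ⟨iff_of_true h₁ h₂, iff_of_false (Pom.asymm h₁) (Pom.asymm h₂)⟩
  · exact h c (by simp [hc, hcA]) b (.inr hb) b' (.inr hb')

theorem IsModule.left_of_incomp (h : IsModule Q (A ∪ B)) (hi : ∀ a ∈ A, ∀ b ∈ B, Q.Incomp a b) :
    IsModule Q A := by
  intro c hc a ha a' ha'
  by_cases hcB : c ∈ B
  · obtain ⟨-, h₁, h₂⟩ := hi a ha c hcB
    obtain ⟨-, h₁', h₂'⟩ := hi a' ha' c hcB
    exact ⟨iff_of_false h₂ h₂', iff_of_false h₁ h₁'⟩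
  · exact h c (by simp [hc, hcB]) a (.inl ha) a' (.inl ha')

theorem Pom.IsLinearSegment.incomp {S : Set Q.Occ} (hS : Q.IsLinearSegment S) {b c d : Q.Occ}
    (hb : b ∈ S) (hc : c ∈ S) (hi : Q.Incomp c d) : Q.Incomp b d := by
  have hd : d ∉ S := fun hd => (hS.1 c hc d hd hi.1).elim hi.2.1 hi.2.2
  obtain ⟨h₁, h₂⟩ := hS.2 d hd b hb c hc
  exact ⟨fun h => hd (h ▸ hb), fun h => hi.2.1 (h₂.1 h), fun h => hi.2.2 (h₁.1 h)⟩

theorem ComponentClosed.of_incomp (h : IsModule Q (A ∪ B)) (hB : B.Nonempty)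
    (hi : ∀ a ∈ A, ∀ b ∈ B, Q.Incomp a b) : ComponentClosed Q A := by
  intro S hS a haS haA c hcS
  by_contra hcA
  obtain ⟨d, hd⟩ := hB
  have hcd : Q.Incomp c d := hS.prop.incomp hcS haS (hi a haA d hd)
  have hac : Q.lt a c ∨ Q.lt c a := hS.prop.1 a haS c hcS fun h => hcA (h ▸ haA)
  by_cases hcB : c ∈ B
  · exact hac.elim (hi a haA c hcB).2.1 (hi a haA c hcB).2.2
  · obtain ⟨h₁, h₂⟩ := h c (by simp [hcA, hcB]) a (.inl haA) d (.inr hd)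
    exact hac.elim (fun h => hcd.2.2 (h₂.1 h)) fun h => hcd.2.1 (h₁.1 h)

end Modules

section Balancing

variable {Loc V : Type*} {P : Pom (TSOAct Loc V)} {ω : BufOcc P ≃ GlobOcc P} {A : Set P.Occ}
  {x : Loc} {v : V} {r : P.Occ}

theorem IsBalancing.glob_lt_or_mem_component (h : IsBalancing P ω) {b : BufOcc P} {c : P.Occ}
    (hlt : P.lt b.1 c) : P.lt (ω b).1 c ∨ ∃ S, P.IsSPComponent S ∧ b.1 ∈ S ∧ c ∈ S := by
  obtain ⟨S, hS, hb, hg⟩ := h.component b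
  by_cases hc : c ∈ S
  · exact .inr ⟨S, hS, hb, hc⟩
  · exact .inl ((hS.prop.2 c hc b.1 hb _ hg).2.1 hlt)

theorem IsBalancing.glob_lt_glob (h : IsBalancing P ω) {b b' : BufOcc P} (hlt : P.lt b.1 b'.1) :
    P.lt (ω b).1 (ω b').1 := by
  rcases h.glob_lt_or_mem_component hlt with h' | ⟨S, hS, hb, hb'⟩
  · exact P.trans _ _ _ h' (h.below b')
  · exact (h.order S hS b b' hb hb').1 hlt

theorem IsBalancing.glob_lt_of_fork (h : IsBalancing P ω) {b : BufOcc P} {c d : P.Occ}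
    (hc : P.lt b.1 c) (hd : P.lt b.1 d) (hi : P.Incomp c d) : P.lt (ω b).1 c := by
  rcases h.glob_lt_or_mem_component hc with h' | ⟨S, hS, hbS, hcS⟩
  · exact h'
  · exact absurd hd (hS.prop.incomp hbS hcS hi).2.1

theorem IsBalancing.glob_lt_of_join (h : IsBalancing P ω) {b : BufOcc P} {c d : P.Occ}
    (hb : P.lt b.1 c) (hd : P.lt d c) (hi : P.Incomp b.1 d) : P.lt (ω b).1 c := by
  rcases h.glob_lt_or_mem_component hb with h' | ⟨S, hS, hbS, hcS⟩
  · exact h'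
  · exact absurd hd (hS.prop.incomp hcS hbS hi).2.2

theorem IsBalancing.label_glob_iff (h : IsBalancing P ω) (b : BufOcc P) :
    P.label (ω b).1 = .po (.write x v) ↔ P.label b.1 = .bufWrite x v := by
  have hl := h.label b
  have hbuf := b.2
  have hglob := (ω b).2
  generalize P.label b.1 = l at hl hbuf ⊢
  generalize P.label (ω b).1 = l' at hl hglob ⊢
  rcases l with _ | ⟨y, u⟩ <;> rcases l' with (_ | _ | _) | _ <;>
    simp_all [TSOAct.toPO, TSOAct.isBuf, TSOAct.isGlob]

theorem IsBalancing.globTo_iff (h : IsBalancing P ω) (b : BufOcc P) :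
    GlobTo P x (ω b).1 ↔ BufTo P x b.1 := exists_congr fun _ => h.label_glob_iff b

theorem IsBalancing.mem_iff (h : IsBalancing P ω) (hA : ComponentClosed P A) (b : BufOcc P) :
    b.1 ∈ A ↔ (ω b).1 ∈ A := by
  obtain ⟨S, hS, hb, hg⟩ := h.component b
  exact ⟨fun h => hA S hS _ hb h hg, fun h => hA S hS _ hg h hb⟩

theorem BufTo.isBuf {a : P.Occ} (h : BufTo P x a) : (P.label a).isBuf = true := by
  obtain ⟨v, hv⟩ := h
  rw [hv]
  rfl

theorem GlobTo.isGlob {a : P.Occ} (h : GlobTo P x a) : (P.label a).isGlob = true := by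
  obtain ⟨v, hv⟩ := h
  rw [hv]
  rfl

theorem bufs_eq_ncard_bufOcc (D : Set P.Occ) :
    bufs P x D = {b : BufOcc P | BufTo P x b.1 ∧ b.1 ∈ D}.ncard := by
  rw [← Set.ncard_image_of_injective _ Subtype.val_injective, bufs]
  congr 1
  ext a
  constructor
  · rintro ⟨ha, hx⟩
    exact ⟨⟨a, hx.isBuf⟩, ⟨hx, ha⟩, rfl⟩
  · rintro ⟨b, ⟨hx, hb⟩, rfl⟩
    exact ⟨hb, hx⟩

theorem IsBalancing.globs_eq_ncard_bufOcc (h : IsBalancing P ω) (D : Set P.Occ) :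
    globs P x D = {b : BufOcc P | BufTo P x b.1 ∧ (ω b).1 ∈ D}.ncard := by
  rw [← Set.ncard_image_of_injective _ (Subtype.val_injective.comp ω.injective), globs]
  congr 1
  ext a
  constructor
  · rintro ⟨ha, hx⟩
    obtain ⟨b, hb⟩ := ω.surjective ⟨a, hx.isGlob⟩
    obtain rfl : (ω b).1 = a := by rw [hb]
    exact ⟨b, ⟨(h.globTo_iff b).1 hx, ha⟩, rfl⟩
  · rintro ⟨b, ⟨hx, hb⟩, rfl⟩
    exact ⟨hb, (h.globTo_iff b).2 hx⟩

/-- Every buffer write to `x` below `r` is matched by a global write below `r`. -/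
def Flushed (ω : BufOcc P ≃ GlobOcc P) (x : Loc) (r : P.Occ) : Prop :=
  ∀ b : BufOcc P, BufTo P x b.1 → P.lt b.1 r → P.lt (ω b).1 r

/-- A buffer write of `v` to `x` is maximal among the buffer writes to `x` below `r`, and the
matching global write is above `r`. -/
def Forwarded (ω : BufOcc P ≃ GlobOcc P) (x : Loc) (v : V) (r : P.Occ) : Prop :=
  ∃ b : BufOcc P, P.label b.1 = .bufWrite x v ∧ P.lt b.1 r ∧ P.lt r (ω b).1 ∧
    ∀ b', BufTo P x b' → P.lt b' r → ¬ P.lt b.1 b'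

theorem IsBalancing.flushed [Finite P.Occ] (h : IsBalancing P ω) (hA : ComponentClosed P A)
    (hr : r ∈ A) (hcount : bufs P x {a ∈ A | P.lt a r} = globs P x {a ∈ A | P.lt a r}) :
    Flushed ω x r := by
  intro b hbx hbr
  rcases h.glob_lt_or_mem_component hbr with h' | ⟨S, hS, hbS, hrS⟩
  · exact h'
  have hbA : b.1 ∈ A := hA S hS r hrS hr hbS
  rw [bufs_eq_ncard_bufOcc, h.globs_eq_ncard_bufOcc] at hcount
  have hglob : {b : BufOcc P | BufTo P x b.1 ∧ (ω b).1 ∈ {a ∈ A | P.lt a r}} =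
      {b : BufOcc P | BufTo P x b.1 ∧ b.1 ∈ {a ∈ A | P.lt a r}} :=
    Set.eq_of_subset_of_ncard_le (fun b' ⟨hx, hbA', hbr'⟩ =>
      ⟨hx, (h.mem_iff hA b').2 hbA', P.trans _ _ _ (h.below b') hbr'⟩) hcount.le
  exact (hglob.ge ⟨hbx, hbA, hbr⟩).2.2

theorem IsBalancing.forwarded [Finite P.Occ] (h : IsBalancing P ω) (hA : ComponentClosed P A)
    (hmod : IsModule P A) (hr : r ∈ A) (hread : (P.label r).isGlob = false)
    (htot : ∀ a ∈ A, a ≠ r → P.lt a r ∨ P.lt r a)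
    (hcount : globs P x {a ∈ A | P.lt a r} < bufs P x {a ∈ A | P.lt a r})
    (hlast : LastBuf P x {a ∈ A | P.lt a r} v) : Forwarded ω x v r := by
  obtain ⟨b, ⟨hbA, hbr⟩, hbx, hmax⟩ := hlast
  lift b to BufOcc P using BufTo.isBuf ⟨v, hbx⟩
  have hωA {b' : BufOcc P} : b'.1 ∈ A → (ω b').1 ∈ A := (h.mem_iff hA b').1
  refine ⟨b, hbx, hbr, ?_, fun b' hb'x hb'r hlt => ?_⟩
  · refine (htot _ (hωA hbA) fun he => ?_).resolve_left fun hgr => hcount.not_ge ?_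
    · simp [← he, (ω b).2] at hread
    · rw [bufs_eq_ncard_bufOcc, h.globs_eq_ncard_bufOcc]
      refine Set.ncard_le_ncard fun b' ⟨hx, hb'⟩ => ⟨hx, hωA hb'.1, ?_⟩
      rcases hmax b' hb' hx with he | hlt
      · exact Subtype.ext he ▸ hgr
      · exact P.trans _ _ _ (h.glob_lt_glob hlt) hgr
  · by_cases hb'A : b' ∈ A
    · rcases hmax b' ⟨hb'A, hb'r⟩ hb'x with rfl | h'
      exacts [P.irrefl _ hlt, Pom.asymm hlt h']
    · exact Pom.asymm hb'r ((hmod b' hb'A b.1 hbA r hr).2.1 hlt)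

end Balancing

/-! ### Write histories -/

section Writes

variable {Loc V : Type*}

open Classical in
/-- The value of the last write to `x` in a list of writes. -/
noncomputable def lastVal (x : Loc) (E : List (Loc × V)) : Option V :=
  (E.filterMap fun w => if x = w.1 then some w.2 else none).getLast?

open Classical in
@[simp] theorem lastVal_singleton (x y : Loc) (v : V) :
    lastVal x [(y, v)] = if x = y then some v else none := by
  by_cases h : x = y <;> simp [lastVal, h]

theorem lastVal_append (x : Loc) (E₁ E₂ : List (Loc × V)) :
    lastVal x (E₁ ++ E₂) = (lastVal x E₂).or (lastVal x E₁) := by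
  rw [lastVal, List.filterMap_append, List.getLast?_append]
  rfl

theorem lastVal_eq_none_iff {x : Loc} {E : List (Loc × V)} :
    lastVal x E = none ↔ ∀ v, (x, v) ∉ E := by
  rw [lastVal, List.getLast?_eq_none_iff, List.filterMap_eq_nil_iff]
  constructor
  · intro h v hv
    simpa using h _ hv
  · exact fun h w hw => if_neg fun hxy => h w.2 (by rwa [hxy])

theorem eq_append_of_lastVal_eq_some {x : Loc} {v : V} {E : List (Loc × V)}
    (h : lastVal x E = some v) : ∃ E₁ E₂, E = E₁ ++ (x, v) :: E₂ ∧ lastVal x E₂ = none := by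
  obtain ⟨vs, hvs⟩ := List.getLast?_eq_some_iff.1 h
  obtain ⟨E₁, E', rfl, -, hE'⟩ := List.filterMap_eq_append_iff.1 hvs
  obtain ⟨E₂, ⟨y, u⟩, E₃, rfl, -, hyu, hE₃⟩ := List.filterMap_eq_cons_iff.1 hE'
  obtain ⟨rfl, rfl⟩ : x = y ∧ u = v := by simpa using hyu
  exact ⟨E₁ ++ E₂, E₃, by simp, by rw [lastVal, hE₃, List.getLast?_nil]⟩

/-- The global write that an action performs, if any. -/
def TSOAct.written : TSOAct Loc V → Option (Loc × V)
  | .po (.write x v) => some (x, v)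
  | _ => none

theorem TSOAct.written_eq_some_iff {l : TSOAct Loc V} {x : Loc} {v : V} :
    l.written = some (x, v) ↔ l = .po (.write x v) := by
  rcases l with (_ | _ | _) | _ <;> simp [TSOAct.written]

/-- The global writes of an environment, both those of `P` and the foreign ones. -/
def writes (P : Pom (TSOAct Loc V)) (Λ : Env P) : List (Loc × V) :=
  Λ.filterMap (Sum.elim (fun a => (P.label a).written) some)

variable {P : Pom (TSOAct Loc V)}

theorem writes_append (Λ₁ Λ₂ : Env P) : writes P (Λ₁ ++ Λ₂) = writes P Λ₁ ++ writes P Λ₂ :=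
  List.filterMap_append

theorem writes_map_inr (E : List (Loc × V)) : writes P (E.map Sum.inr) = E := by
  rw [writes, List.filterMap_map]
  exact List.filterMap_some

theorem writes_singleton_inl (a : P.Occ) : writes P [.inl a] = (P.label a).written.toList := by
  cases h : (P.label a).written <;> simp [writes, h]

theorem viewEntry_inl_of_notMem {A : Set P.Occ} {a : P.Occ} (ha : a ∉ A) :
    viewEntry P A (.inl a) = (P.label a).written.map Sum.inr := by
  simp only [viewEntry, if_neg ha]
  rcases P.label a with (_ | _ | _) | _ <;> rfl

theorem viewEntry_eq_inl {A : Set P.Occ} {e : P.Occ ⊕ (Loc × V)} {r : P.Occ}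
    (h : viewEntry P A e = some (.inl r)) : e = .inl r := by
  rcases e with a | w
  · by_cases ha : a ∈ A
    · simpa [viewEntry, ha] using h
    · simp [viewEntry_inl_of_notMem ha] at h
  · simp [viewEntry] at h

theorem writes_view (A : Set P.Occ) (Λ : Env P) : writes P (view P A Λ) = writes P Λ := by
  rw [writes, view, List.filterMap_filterMap, writes]
  congr 1
  funext e
  rcases e with a | w
  · by_cases ha : a ∈ A
    · simp [viewEntry, ha]
    · rw [viewEntry_inl_of_notMem ha]
      cases h : (P.label a).written <;> simp [h]
  · rfl

theorem exists_of_view_eq_append_cons {A : Set P.Occ} {Λ E₁ E₂ : Env P} {r : P.Occ}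
    (h : view P A Λ = E₁ ++ .inl r :: E₂) :
    ∃ Λ₁ Λ₂, Λ = Λ₁ ++ .inl r :: Λ₂ ∧ writes P Λ₁ = writes P E₁ := by
  obtain ⟨Λ₁, Λ', rfl, h₁, h'⟩ := List.filterMap_eq_append_iff.1 h
  obtain ⟨Λ₂, e, Λ₃, rfl, h₂, he, -⟩ := List.filterMap_eq_cons_iff.1 h'
  refine ⟨Λ₁ ++ Λ₂, Λ₃, by simp [viewEntry_eq_inl he], ?_⟩
  rw [← writes_view A (Λ₁ ++ Λ₂), view, List.filterMap_append, h₁,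
    List.filterMap_eq_nil_iff.2 h₂, List.append_nil]

end Writes

/-! ### Invariants of footprints -/

section Footprints

variable {Loc V : Type*} {l : TSOAct Loc V} {E E₁ E₂ : List (Loc × V)} {σ τ : BState Loc V}

theorem buf_eq_empty_of_mem_envFoot (h : (σ, τ) ∈ envFoot E) :
    σ.buf = .empty ∧ τ.buf = .empty := by
  induction E generalizing σ τ with
  | nil => cases h; exact ⟨rfl, rfl⟩
  | cons w E ih =>
    obtain ⟨_, _, _, _, ⟨v', ⟨⟩⟩, h₂, -, ⟨⟩⟩ := h
    simp [BState.union, BState.diff, BState.update, ih h₂]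

theorem mem_eq_lastVal_of_mem_envFoot (h : (σ, τ) ∈ envFoot E) (x : Loc) :
    τ.mem.toFun x = lastVal x E := by
  induction E generalizing σ τ with
  | nil => cases h; rfl
  | cons w E ih =>
    obtain ⟨_, _, _, _, ⟨v', ⟨⟩⟩, h₂, -, ⟨⟩⟩ := h
    rw [← List.singleton_append, lastVal_append, lastVal_singleton, ← ih h₂]
    simp [BState.update]

theorem mem_eq_lastVal_of_mem_actFoot (h : (σ, τ) ∈ actFoot l) (x : Loc) :
    τ.mem.toFun x = lastVal x l.written.toList := by
  rcases l with (⟨y, v⟩ | ⟨y, v⟩ | _) | ⟨y, v⟩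
  · obtain ⟨v', v'', n, ⟨⟩⟩ := h
    simp [TSOAct.written]
  · rcases h with ⟨⟨⟩⟩ | ⟨n, ⟨⟩⟩ <;> rfl
  · cases h
    rfl
  · obtain ⟨v', n, ⟨⟩⟩ := h
    rfl

theorem exists_mem_actFoot_of_mem_seqFoot
    (h : (σ, τ) ∈ seqFoot (seqFoot (envFoot E₁) (actFoot l)) (envFoot E₂)) :
    ∃ σ₀ τ₀, (σ₀, τ₀) ∈ actFoot l ∧ σ.buf = σ₀.buf ∧ τ.buf = τ₀.buf ∧
      (∀ x, τ.mem.toFun x = (lastVal x E₂).or ((τ₀.mem.toFun x).or (lastVal x E₁))) ∧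
      ∀ x v, σ₀.mem.toFun x = some v → (lastVal x E₁).or (σ.mem.toFun x) = some v := by
  obtain ⟨_, _, σ₃, τ₃, ⟨σ₁, τ₁, σ₂, τ₂, h₁, h₂, hc, ⟨⟩⟩, h₃, -, ⟨⟩⟩ := h
  obtain ⟨hσ₁, hτ₁⟩ := buf_eq_empty_of_mem_envFoot h₁
  obtain ⟨hσ₃, hτ₃⟩ := buf_eq_empty_of_mem_envFoot h₃
  refine ⟨σ₂, τ₂, h₂, ?_, ?_, fun x => ?_, fun x v hv => ?_⟩
  · simp [BState.union, BState.diff, hσ₁, hτ₁, hσ₃]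
  · simp [BState.update, hτ₁, hτ₃]
  · simp [BState.update, mem_eq_lastVal_of_mem_envFoot h₁, mem_eq_lastVal_of_mem_envFoot h₃]
  · have h := hc.2.toFun_seq_eq_some hv
    rw [FinPart.toFun_update, mem_eq_lastVal_of_mem_envFoot h₁] at h
    rw [BState.union, FinPart.toFun_union, ← Option.or_assoc, BState.union, BState.diff, h,
      Option.some_or]

variable {P : Pom (TSOAct Loc V)} {A : Set P.Occ} {Λ : Env P}

theorem FootOn.nonempty (h : FootOn P A Λ σ τ) : A.Nonempty := by
  induction h with
  | act a => exact ⟨a, rfl⟩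
  | seq _ _ _ _ _ _ _ _ _ _ _ _ _ _ ih => exact ih.inl
  | par _ _ _ _ _ _ _ _ _ _ _ _ _ _ _ _ ih => exact ih.inl

theorem FootOn.mem_eq_lastVal (h : FootOn P A Λ σ τ) (x : Loc) :
    τ.mem.toFun x = lastVal x (writes P Λ) := by
  induction h with
  | act a E₁ E₂ σ τ h =>
    obtain ⟨σ₀, τ₀, h₀, -, -, hτ, -⟩ := exists_mem_actFoot_of_mem_seqFoot h
    rw [hτ, mem_eq_lastVal_of_mem_actFoot h₀, writes_append, writes_append, writes_map_inr,
      writes_map_inr, writes_singleton_inl, lastVal_append, lastVal_append]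
  | seq A₁ A₂ Λ₁ Λ₂ σ₁ τ₁ σ₂ τ₂ _ _ _ _ _ _ ih₁ ih₂ =>
    rw [writes_append, lastVal_append, ← ih₁, ← ih₂]
    exact FinPart.toFun_update τ₁.mem τ₂.mem x
  | par A₁ A₂ Λ σ₁ τ₁ σ₂ τ₂ _ _ _ _ _ _ _ _ _ ih₁ ih₂ =>
    rw [BState.union, FinPart.toFun_union, ih₁, ih₂, writes_view, writes_view, Option.or_self]

end Footprints

section BufStep

variable {Loc V : Type*} {P : Pom (TSOAct Loc V)} {x : Loc} {A A₁ A₂ : Set P.Occ} {a : P.Occ}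
  {σ τ : BState Loc V}

/-- The footstep `(σ, τ)` of buffers acts on the buffer of `x` as the occurrences in `A` can, and
it leaves this buffer alone unless it inspects it. -/
structure BufStep (P : Pom (TSOAct Loc V)) (x : Loc) (A : Set P.Occ)
    (σ τ : FinPart Loc (BufVal V)) : Prop where
  untouched : σ.toFun x = none → τ.toFun x = none ∧ bufs P x A = 0
  run : ∀ β, σ.AgreesWith β → BufRun P x A (β x) (τ.override β x)

theorem BufStep.seq [Finite P.Occ] {σ₁ τ₁ σ₂ τ₂ : FinPart Loc (BufVal V)}
    (hlt : ∀ a ∈ A₁, ∀ b ∈ A₂, P.lt a b) (hc : (σ₁.update τ₁).Consistent σ₂)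
    (h₁ : BufStep P x A₁ σ₁ τ₁) (h₂ : BufStep P x A₂ σ₂ τ₂) :
    BufStep P x (A₁ ∪ A₂) (σ₁.union (σ₂.diff τ₁)) (τ₁.update τ₂) := by
  refine ⟨fun h => ?_, fun β hβ => ?_⟩
  · obtain ⟨hσ₁, hσ₂⟩ := Option.or_eq_none_iff.1 h
    obtain ⟨hτ₁, hbufs₁⟩ := h₁.untouched hσ₁
    obtain ⟨hτ₂, hbufs₂⟩ := h₂.untouched (by simpa [hτ₁] using hσ₂)
    exact ⟨by simp [hτ₁, hτ₂], by rw [bufs_union (disjoint_of_lt hlt), hbufs₁, hbufs₂]⟩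
  · obtain ⟨hβ₁, hβ₂⟩ := hc.agreesWith_of_seq hβ
    rw [FinPart.override_update]
    exact (h₁.run β hβ₁).trans hlt (h₂.run _ hβ₂)

theorem BState.EmptyBuf.count_eq_zero (h : σ.EmptyBuf) {β : BufVal V}
    (hβ : σ.buf.toFun x = some β) : β.count = 0 := by
  obtain ⟨v, hv⟩ := h x (by simp [FinPart.dom, hβ])
  rw [Option.some.inj (hβ.symm.trans hv), BufVal.count_bufVal]

theorem BState.EmptyBuf.count_override (h : σ.EmptyBuf) {β : Loc → BufVal V}
    (hβ : (β x).count = 0) : (σ.buf.override β x).count = 0 := by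
  cases hx : σ.buf.toFun x with
  | none => rwa [FinPart.override_of_eq_none hx]
  | some p => rw [FinPart.override_of_eq_some hx]; exact h.count_eq_zero hx

theorem BState.EmptyBuf.exists_agreesWith [Nonempty V] (h : σ.EmptyBuf) :
    ∃ β, σ.buf.AgreesWith β ∧ ∀ x, (β x).count = 0 :=
  ⟨_, σ.buf.agreesWith_override fun _ => bufVal (Classical.arbitrary V) 0,
    fun _ => h.count_override (BufVal.count_bufVal _ 0)⟩

theorem BState.EmptyBuf.eq_none_of_agreesWith (h : σ.EmptyBuf) {β : Loc → BufVal V}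
    (hβ : σ.buf.AgreesWith β) (h0 : (β x).count ≠ 0) : σ.buf.toFun x = none := by
  by_contra hx
  obtain ⟨p, hp⟩ := Option.ne_none_iff_exists'.1 hx
  exact h0 (hβ x p hp ▸ h.count_eq_zero hp)

theorem BState.EmptyBuf.union {σ' : BState Loc V} (h : σ.EmptyBuf) (h' : σ'.EmptyBuf) :
    (σ.union σ').EmptyBuf := by
  intro x hx
  cases hs : σ.buf.toFun x with
  | none =>
    obtain ⟨v, hv⟩ := h' x (by simpa [FinPart.dom, BState.union, hs] using hx)
    exact ⟨v, by simp [BState.union, hs, hv]⟩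
  | some p =>
    obtain ⟨v, hv⟩ := h x (by simp [FinPart.dom, hs])
    exact ⟨v, by simp [BState.union, hv]⟩

theorem BufStep.par [Finite P.Occ] {σ₁ τ₁ σ₂ τ₂ : BState Loc V} (hd : Disjoint A₁ A₂)
    (hσ₁ : σ₁.EmptyBuf) (hτ₁ : τ₁.EmptyBuf) (hσ₂ : σ₂.EmptyBuf) (hτ₂ : τ₂.EmptyBuf)
    (hc : σ₁.Consistent σ₂) (h₁ : BufStep P x A₁ σ₁.buf τ₁.buf)
    (h₂ : BufStep P x A₂ σ₂.buf τ₂.buf) :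
    BufStep P x (A₁ ∪ A₂) (σ₁.union σ₂).buf (τ₁.union τ₂).buf := by
  refine ⟨fun h => ?_, fun β hβ => ?_⟩
  · obtain ⟨hs₁, hs₂⟩ := Option.or_eq_none_iff.1 h
    obtain ⟨ht₁, hbufs₁⟩ := h₁.untouched hs₁
    obtain ⟨ht₂, hbufs₂⟩ := h₂.untouched hs₂
    exact ⟨by simp [BState.union, ht₁, ht₂], by rw [bufs_union hd, hbufs₁, hbufs₂]⟩
  · obtain ⟨hβ₁, hβ₂⟩ := hc.1.agreesWith_of_union hβ
    have c₁ := (h₁.run β hβ₁).count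
    have c₂ := (h₂.run β hβ₂).count
    by_cases h0 : (β x).count = 0
    · have f₁ := hτ₁.count_override h0
      have f₂ := hτ₂.count_override h0
      have f := (hτ₁.union hτ₂).count_override h0
      exact ⟨by rw [bufs_union hd, globs_union hd]; omega, fun v hv => absurd f hv.count_ne_zero⟩
    · obtain ⟨ht₁, hbufs₁⟩ := h₁.untouched (hσ₁.eq_none_of_agreesWith hβ₁ h0)
      obtain ⟨ht₂, hbufs₂⟩ := h₂.untouched (hσ₂.eq_none_of_agreesWith hβ₂ h0)
      have ht : (τ₁.union τ₂).buf.toFun x = none := by simp [BState.union, ht₁, ht₂]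
      rw [FinPart.override_of_eq_none ht₁] at c₁
      rw [FinPart.override_of_eq_none ht₂] at c₂
      rw [FinPart.override_of_eq_none ht]
      have hbufs : bufs P x (A₁ ∪ A₂) = 0 := by rw [bufs_union hd, hbufs₁, hbufs₂]
      exact ⟨by rw [hbufs, globs_union hd]; omega, fun v hv => .inr ⟨hbufs, hv⟩⟩

open Classical in
theorem bufs_singleton : bufs P x {a} = if BufTo P x a then 1 else 0 := by
  split_ifs with h <;> simp [bufs, Set.singleton_inter_of_mem, Set.singleton_inter_of_notMem, h]

open Classical in
theorem globs_singleton : globs P x {a} = if GlobTo P x a then 1 else 0 := by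
  split_ifs with h <;> simp [globs, Set.singleton_inter_of_mem, Set.singleton_inter_of_notMem, h]

theorem BufStep.of_not_write {σ τ : FinPart Loc (BufVal V)} (hb : ¬ BufTo P x a)
    (hg : ¬ GlobTo P x a) (hτ : τ.toFun x = none) : BufStep P x {a} σ τ := by
  have hbufs : bufs P x {a} = 0 := by rw [bufs_singleton, if_neg hb]
  refine ⟨fun _ => ⟨hτ, hbufs⟩, fun β _ => ?_⟩
  rw [FinPart.override_of_eq_none hτ]
  exact ⟨by rw [hbufs, globs_singleton, if_neg hg], fun v hv => .inr ⟨hbufs, hv⟩⟩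

theorem BufStep.of_run {p q : BufVal V} (h : BufRun P x A p q) :
    BufStep P x A (.single x p) (.single x q) := by
  refine ⟨by simp, fun β hβ => ?_⟩
  rwa [hβ x p (by simp), FinPart.override_of_eq_some (b := q) (by simp)]

theorem BufRun.globalWrite {v w : V} {n : ℕ} (h : P.label a = .po (.write x v)) :
    BufRun P x {a} (bufVal w (n + 1)) (bufVal w n) := by
  have hb : ¬ BufTo P x a := by simp [BufTo, h]
  have hbufs : bufs P x {a} = 0 := by rw [bufs_singleton, if_neg hb]
  refine ⟨?_, fun u hu => .inr ⟨hbufs, by simp_all⟩⟩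
  rw [hbufs, globs_singleton, if_pos ⟨v, h⟩]
  rfl

theorem BufRun.bufferWrite {v w : V} {n : ℕ} (h : P.label a = .bufWrite x v) :
    BufRun P x {a} (bufVal w n) (bufVal v (n + 1)) := by
  have hg : ¬ GlobTo P x a := by simp [GlobTo, h]
  refine ⟨?_, fun u hu => .inl ⟨a, rfl, ?_, fun b hb _ => .inl hb⟩⟩
  · rw [bufs_singleton, globs_singleton, if_pos ⟨v, h⟩, if_neg hg]
    rfl
  · rw [h, (BufVal.hasTop_bufVal.1 hu).2]

theorem BufStep.act (h : (σ, τ) ∈ actFoot (P.label a)) : BufStep P x {a} σ.buf τ.buf := by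
  rcases hl : P.label a with (⟨y, v⟩ | ⟨y, v⟩ | _) | ⟨y, v⟩ <;> rw [hl] at h
  · obtain ⟨v', w, n, ⟨⟩⟩ := h
    by_cases hxy : x = y
    · subst hxy
      exact .of_run (.globalWrite hl)
    · exact .of_not_write (by simp [BufTo, hl]) (by simp [GlobTo, hl, Ne.symm hxy]) (by simp [hxy])
  · have hτ : τ.buf.toFun x = none := by rcases h with ⟨⟨⟩⟩ | ⟨n, ⟨⟩⟩ <;> rfl
    exact .of_not_write (by simp [BufTo, hl]) (by simp [GlobTo, hl]) hτ
  · cases h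
    exact .of_not_write (by simp [BufTo, hl]) (by simp [GlobTo, hl]) rfl
  · obtain ⟨w, n, ⟨⟩⟩ := h
    by_cases hxy : x = y
    · subst hxy
      exact .of_run (.bufferWrite hl)
    · exact .of_not_write (by simp [BufTo, hl, Ne.symm hxy]) (by simp [GlobTo, hl]) (by simp [hxy])

theorem FootOn.bufStep [Finite P.Occ] {Λ : Env P} (h : FootOn P A Λ σ τ) :
    BufStep P x A σ.buf τ.buf := by
  induction h with
  | act a E₁ E₂ σ τ h =>
    obtain ⟨σ₀, τ₀, h₀, hσ, hτ, -⟩ := exists_mem_actFoot_of_mem_seqFoot h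
    rw [hσ, hτ]
    exact .act h₀
  | seq _ _ _ _ _ _ _ _ hlt _ _ _ _ hc ih₁ ih₂ => exact .seq hlt hc.1 ih₁ ih₂
  | par _ _ _ _ _ _ _ hi _ _ _ hσ₁ hτ₁ hσ₂ hτ₂ hc ih₁ ih₂ =>
    exact .par (disjoint_of_incomp hi) hσ₁ hτ₁ hσ₂ hτ₂ hc ih₁ ih₂

end BufStep

/-! ### Reads -/

section Reads

variable {Loc V : Type*} {P : Pom (TSOAct Loc V)} {ω : BufOcc P ≃ GlobOcc P} {x : Loc} {v : V}
  {r : P.Occ} {A A₁ A₂ : Set P.Occ} {M M' : Prop}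

/-- When `r` comes up in the environment `Λ` started in `σ`, the memory has the value `v` for
`x`. -/
def MemRead (P : Pom (TSOAct Loc V)) (x : Loc) (v : V) (Λ : Env P) (σ : BState Loc V)
    (r : P.Occ) : Prop :=
  ∃ Λ₁ Λ₂, Λ = Λ₁ ++ .inl r :: Λ₂ ∧ (lastVal x (writes P Λ₁)).or (σ.mem.toFun x) = some v

theorem MemRead.seq_left {Λ₁ Λ₂ : Env P} {σ₁ τ₁ σ₂ : BState Loc V} (h : MemRead P x v Λ₁ σ₁ r) :
    MemRead P x v (Λ₁ ++ Λ₂) (σ₁.union (σ₂.diff τ₁)) r := by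
  obtain ⟨E₁, E₂, rfl, h⟩ := h
  refine ⟨E₁, E₂ ++ Λ₂, by simp, ?_⟩
  rw [BState.union, FinPart.toFun_union, ← Option.or_assoc, h, Option.some_or]

theorem MemRead.seq_right {Λ₁ Λ₂ : Env P} {σ₁ τ₁ σ₂ : BState Loc V} (h : MemRead P x v Λ₂ σ₂ r)
    (h₁ : FootOn P A Λ₁ σ₁ τ₁) (hc : (σ₁.update τ₁).Consistent σ₂) :
    MemRead P x v (Λ₁ ++ Λ₂) (σ₁.union (σ₂.diff τ₁)) r := by
  obtain ⟨E₁, E₂, rfl, h⟩ := h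
  refine ⟨Λ₁ ++ E₁, E₂, by simp, ?_⟩
  rw [writes_append, lastVal_append, ← h₁.mem_eq_lastVal, Option.or_assoc]
  cases hE : lastVal x (writes P E₁) with
  | some u => simpa [hE] using h
  | none =>
    rw [Option.none_or, BState.union, BState.diff, ← FinPart.toFun_update]
    exact hc.2.toFun_seq_eq_some (by simpa [hE] using h)

theorem MemRead.of_view {Λ : Env P} {σ σ' : BState Loc V} (h : MemRead P x v (view P A Λ) σ r)
    (hσ : σ.mem.toFun x = some v → σ'.mem.toFun x = some v) : MemRead P x v Λ σ' r := by
  obtain ⟨E₁, E₂, heq, h⟩ := h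
  obtain ⟨Λ₁, Λ₂, rfl, hw⟩ := exists_of_view_eq_append_cons heq
  refine ⟨Λ₁, Λ₂, rfl, ?_⟩
  rw [hw]
  cases hE : lastVal x (writes P E₁) with
  | some u => simpa [hE] using h
  | none => simpa using hσ (by simpa [hE] using h)

/-- A read `r` of `v` from `x` that has found its source: either the memory, in which case `M` holds
and all buffer writes to `x` below `r` have been flushed, or a buffer write. -/
def Resolved (ω : BufOcc P ≃ GlobOcc P) (x : Loc) (v : V) (M : Prop) (r : P.Occ) : Prop :=
  M ∧ Flushed ω x r ∨ Forwarded ω x v r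

theorem Resolved.imp (h : Resolved ω x v M r) (hM : M → M') : Resolved ω x v M' r :=
  Or.imp_left (And.imp_left hM) h

/-- A read `r` of `v` from `x` that is comparable to all of `A`, so that its source still depends on
the buffer at the start of `A`: the run of the occurrences of `A` below `r` leads either to the
empty buffer, in which case `M` holds, or to a buffer with most recent value `v`. -/
structure OpenRead (P : Pom (TSOAct Loc V)) (x : Loc) (v : V) (M : Prop) (A : Set P.Occ)
    (σ : FinPart Loc (BufVal V)) (r : P.Occ) : Prop where
  comparable : ∀ a ∈ A, a ≠ r → P.lt a r ∨ P.lt r a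
  run : ∀ β, σ.AgreesWith β →
    ∃ β', BufRun P x {a ∈ A | P.lt a r} (β x) β' ∧ (β'.count = 0 ∧ M ∨ β'.HasTop v)

theorem OpenRead.imp {σ : FinPart Loc (BufVal V)} (h : OpenRead P x v M A σ r) (hM : M → M') :
    OpenRead P x v M' A σ r := by
  refine ⟨h.comparable, fun β hβ => ?_⟩
  obtain ⟨β', hrun, hβ'⟩ := h.run β hβ
  exact ⟨β', hrun, hβ'.imp_left (And.imp_right hM)⟩

theorem OpenRead.singleton {σ : FinPart Loc (BufVal V)} {p : BufVal V} (hσ : σ.toFun x = some p)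
    (hp : p.count = 0 ∧ M ∨ p.HasTop v) : OpenRead P x v M {r} σ r := by
  refine ⟨fun a ha hne => absurd ha hne, fun β hβ => ⟨p, ?_, hp⟩⟩
  have hempty : {a ∈ ({r} : Set P.Occ) | P.lt a r} = ∅ :=
    Set.eq_empty_of_forall_notMem fun a ⟨ha, har⟩ => P.irrefl r (ha ▸ har)
  rw [hempty, hβ x p hσ]
  exact .empty p

theorem OpenRead.seq_left {σ₁ τ₁ σ₂ : FinPart Loc (BufVal V)}
    (hlt : ∀ a ∈ A₁, ∀ b ∈ A₂, P.lt a b) (hc : (σ₁.update τ₁).Consistent σ₂) (hr : r ∈ A₁)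
    (h : OpenRead P x v M A₁ σ₁ r) : OpenRead P x v M (A₁ ∪ A₂) (σ₁.union (σ₂.diff τ₁)) r := by
  refine ⟨?_, fun β hβ => ?_⟩
  · rintro a (ha | ha) hne
    exacts [h.comparable a ha hne, .inr (hlt r hr a ha)]
  · have hbelow : {a ∈ A₁ ∪ A₂ | P.lt a r} = {a ∈ A₁ | P.lt a r} := by
      ext a
      exact and_congr_left fun har => or_iff_left fun ha => Pom.asymm har (hlt r hr a ha)
    rw [hbelow]
    exact h.run β (hc.agreesWith_of_seq hβ).1

theorem OpenRead.seq_right [Finite P.Occ] {σ₁ τ₁ σ₂ : FinPart Loc (BufVal V)}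
    (hlt : ∀ a ∈ A₁, ∀ b ∈ A₂, P.lt a b) (hc : (σ₁.update τ₁).Consistent σ₂) (hr : r ∈ A₂)
    (h₁ : BufStep P x A₁ σ₁ τ₁) (h : OpenRead P x v M A₂ σ₂ r) :
    OpenRead P x v M (A₁ ∪ A₂) (σ₁.union (σ₂.diff τ₁)) r := by
  refine ⟨?_, fun β hβ => ?_⟩
  · rintro a (ha | ha) hne
    exacts [.inl (hlt a ha r hr), h.comparable a ha hne]
  · have hbelow : {a ∈ A₁ ∪ A₂ | P.lt a r} = A₁ ∪ {a ∈ A₂ | P.lt a r} := by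
      ext a
      exact ⟨fun ⟨ha, har⟩ => ha.imp_right fun ha => ⟨ha, har⟩,
        fun ha => ha.elim (fun ha => ⟨.inl ha, hlt a ha r hr⟩) fun ha => ⟨.inr ha.1, ha.2⟩⟩
    obtain ⟨hβ₁, hβ₂⟩ := hc.agreesWith_of_seq hβ
    obtain ⟨β', hrun, hβ'⟩ := h.run _ hβ₂
    rw [hbelow]
    exact ⟨β', (h₁.run β hβ₁).trans (fun a ha b hb => hlt a ha b hb.1) hrun, hβ'⟩

theorem OpenRead.resolved [Finite P.Occ] (hbal : IsBalancing P ω) (hA : ComponentClosed P A)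
    (hmod : IsModule P A) {σ : BState Loc V} (hσ : σ.EmptyBuf) (hr : r ∈ A)
    (hread : P.label r = .po (.read x v)) (h : OpenRead P x v M A σ.buf r) :
    Resolved ω x v M r := by
  have : Nonempty V := ⟨v⟩
  obtain ⟨β, hβ, h0⟩ := hσ.exists_agreesWith
  obtain ⟨β', hrun, ⟨h0', hM⟩ | htop⟩ := h.run β hβ
  · have hcount := hrun.count
    rw [h0, h0', zero_add, zero_add] at hcount
    exact .inl ⟨hM, hbal.flushed hA hr hcount⟩
  · have hcount := hrun.count
    have hpos := htop.count_ne_zero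
    have hlast := (hrun.top v htop).resolve_right fun h => h.2.count_ne_zero (h0 x)
    exact .inr (hbal.forwarded hA hmod hr (by rw [hread]; rfl) h.comparable
      (by rw [h0] at hcount; omega) hlast)

theorem FootOn.openRead_of_act {E₁ E₂ : List (Loc × V)} {σ τ : BState Loc V}
    (h : (σ, τ) ∈ seqFoot (seqFoot (envFoot E₁) (actFoot (P.label r))) (envFoot E₂))
    (hread : P.label r = .po (.read x v)) :
    OpenRead P x v (MemRead P x v (E₁.map .inr ++ [.inl r] ++ E₂.map .inr) σ r) {r} σ.buf r := by
  obtain ⟨σ₀, τ₀, h₀, hσ, -, -, hmem⟩ := exists_mem_actFoot_of_mem_seqFoot h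
  rw [hread] at h₀
  rw [hσ]
  rcases h₀ with ⟨⟨⟩⟩ | ⟨n, ⟨⟩⟩
  · refine .singleton (p := bufVal v 0) (by simp) (.inl ⟨BufVal.count_bufVal v 0, ?_⟩)
    refine ⟨E₁.map .inr, E₂.map .inr, by simp, ?_⟩
    rw [writes_map_inr]
    exact hmem x v (by simp)
  · exact .singleton (p := bufVal v (n + 1)) (by simp) (.inr ⟨n, rfl⟩)

theorem FootOn.resolved_or_openRead [Finite P.Occ] (hbal : IsBalancing P ω) {Λ : Env P}
    {σ τ : BState Loc V} (h : FootOn P A Λ σ τ) (hmod : IsModule P A) (hr : r ∈ A)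
    (hread : P.label r = .po (.read x v)) :
    Resolved ω x v (MemRead P x v Λ σ r) r ∨ OpenRead P x v (MemRead P x v Λ σ r) A σ.buf r := by
  induction h with
  | act a E₁ E₂ σ τ h =>
    obtain rfl : r = a := hr
    exact .inr (openRead_of_act h hread)
  | seq A₁ A₂ Λ₁ Λ₂ σ₁ τ₁ σ₂ _ hlt _ _ h₁ _ hc ih₁ ih₂ =>
    rcases hr with hr | hr
    · exact (ih₁ (hmod.left_of_lt hlt) hr).imp (·.imp MemRead.seq_left)
        fun h => (h.seq_left hlt hc.1 hr).imp MemRead.seq_left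
    · exact (ih₂ (hmod.right_of_lt hlt) hr).imp (·.imp (·.seq_right h₁ hc))
        fun h => (h.seq_right hlt hc.1 hr h₁.bufStep).imp (·.seq_right h₁ hc)
  | par A₁ A₂ Λ σ₁ τ₁ σ₂ τ₂ hi _ h₁ h₂ hσ₁ _ hσ₂ _ hc ih₁ ih₂ =>
    left
    rcases hr with hr | hr
    · have hA := ComponentClosed.of_incomp hmod h₂.nonempty hi
      have hmod₁ := hmod.left_of_incomp hi
      have hres := (ih₁ hmod₁ hr).elim id (·.resolved hbal hA hmod₁ hσ₁ hr hread)
      exact hres.imp (·.of_view fun hs => by simp [BState.union, hs])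
    · have hi' : ∀ a ∈ A₂, ∀ b ∈ A₁, P.Incomp a b := fun a ha b hb => (hi b hb a ha).symm
      rw [Set.union_comm] at hmod
      have hA := ComponentClosed.of_incomp hmod h₁.nonempty hi'
      have hmod₂ := hmod.left_of_incomp hi'
      have hres := (ih₂ hmod₂ hr).elim id (·.resolved hbal hA hmod₂ hσ₂ hr hread)
      refine hres.imp (·.of_view fun hs => ?_)
      cases hs₁ : σ₁.mem.toFun x with
      | none => simp [BState.union, hs₁, hs]
      | some u => simp [BState.union, hs₁, hc.2.eq hs₁ hs]

theorem resolved_of_mem_zfoot [Finite P.Occ] (hbal : IsBalancing P ω) {Λ : List P.Occ}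
    {σ τ : BState Loc V} (h : (σ, τ) ∈ zfoot P Λ) (hread : P.label r = .po (.read x v)) :
    Resolved ω x v (MemRead P x v (Λ.map .inl) σ r) r :=
  (h.1.resolved_or_openRead hbal isModule_univ (Set.mem_univ r) hread).elim id
    (·.resolved hbal componentClosed_univ isModule_univ h.2.1 (Set.mem_univ r) hread)

end Reads

/-! ### Lists as orders -/

section Precedes

variable {α β : Type*} {l l₁ l₂ : List α} {a b c : α}

theorem precedes_iff_append :
    Precedes l a b ↔ ∃ l₁ l₂, l = l₁ ++ l₂ ∧ a ∈ l₁ ∧ b ∈ l₂ := by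
  rw [Precedes, show [a, b] = [a] ++ [b] from rfl, List.append_sublist_iff]
  simp only [List.singleton_sublist]

theorem precedes_append_cons_self_iff (h : (l₁ ++ b :: l₂).Nodup) :
    Precedes (l₁ ++ b :: l₂) a b ↔ a ∈ l₁ := by
  refine ⟨fun hab => ?_, fun ha => precedes_iff_append.2 ⟨l₁, b :: l₂, rfl, ha, by simp⟩⟩
  have hb : b ∉ l₁ ++ l₂ := (List.nodup_cons.1 (List.nodup_middle.1 h)).1
  obtain ⟨m₁, m₂, heq, ha, hbm⟩ := precedes_iff_append.1 hab
  rcases List.append_eq_append_iff.1 heq with ⟨_ | ⟨_, m⟩, rfl, heq'⟩ | ⟨m, rfl, rfl⟩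
  · simpa using ha
  · obtain ⟨rfl, rfl⟩ := List.cons.inj heq'
    exact absurd (by simp [hbm]) hb
  · exact List.mem_append_left m ha

theorem precedes_append_cons_left_iff (h : (l₁ ++ b :: l₂).Nodup) :
    Precedes (l₁ ++ b :: l₂) b c ↔ c ∈ l₂ := by
  refine ⟨fun hbc => ?_, fun hc => precedes_iff_append.2 ⟨l₁ ++ [b], l₂, by simp, by simp, hc⟩⟩
  have hb : b ∉ l₁ ++ l₂ := (List.nodup_cons.1 (List.nodup_middle.1 h)).1
  obtain ⟨m₁, m₂, heq, hbm, hcm⟩ := precedes_iff_append.1 hbc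
  rcases List.append_eq_append_iff.1 heq with ⟨_ | ⟨_, m⟩, rfl, heq'⟩ | ⟨m, rfl, rfl⟩
  · exact absurd (by simp_all) hb
  · obtain ⟨rfl, rfl⟩ := List.cons.inj heq'
    exact List.mem_append_right m hcm
  · exact absurd (by simp [hbm]) hb

theorem isStrictOrder_precedes (hl : l.Nodup) : IsStrictOrder α (Precedes l) where
  irrefl a := List.nodup_iff_sublist.1 hl a
  trans a b c hab hbc := by
    obtain ⟨l₁, l₂, rfl⟩ := List.append_of_mem (hbc.subset (List.mem_cons_self ..))
    rw [precedes_append_cons_self_iff hl] at hab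
    rw [precedes_append_cons_left_iff hl] at hbc
    exact precedes_iff_append.2 ⟨l₁, b :: l₂, rfl, hab, List.mem_cons_of_mem b hbc⟩

theorem Pom.Enumerates.precedes_or_precedes (hl : Enumerates l) (hab : a ≠ b) :
    Precedes l a b ∨ Precedes l b a := by
  obtain ⟨hnodup, hmem⟩ := hl
  obtain ⟨l₁, l₂, rfl⟩ := List.append_of_mem (hmem b)
  rw [precedes_append_cons_self_iff hnodup, precedes_append_cons_left_iff hnodup]
  simpa [hab] using hmem a

theorem Pom.Enumerates.finite (hl : Enumerates l) : Finite α :=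
  Set.finite_univ_iff.1 (l.finite_toSet.subset fun a _ => hl.2 a)

theorem precedes_map_iff {f : α → β} (hf : f.Injective) :
    Precedes (l.map f) (f a) (f b) ↔ Precedes l a b := by
  refine ⟨fun h => ?_, fun h => List.Sublist.map f h⟩
  obtain ⟨l', hl', heq⟩ := List.sublist_map_iff.1 h
  obtain rfl := List.map_injective_iff.2 hf (a₁ := [a, b]) heq
  exact hl'

theorem precedes_filter_iff {p : α → Bool} (ha : p a = true) (hb : p b = true) :
    Precedes (l.filter p) a b ↔ Precedes l a b := by
  refine ⟨fun h => h.trans List.filter_sublist, fun h => ?_⟩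
  have hfilter := List.Sublist.filter p h
  rwa [List.filter_cons_of_pos ha, List.filter_cons_of_pos hb, List.filter_nil] at hfilter

end Precedes

/-! ### The occurrences of the underlying program order -/

section Rep

variable {Loc V : Type*} {P : Pom (TSOAct Loc V)} {ω : BufOcc P ≃ GlobOcc P} {x : Loc} {v : V}
  {u w : (U P).Occ}

theorem label_U_eq_write_iff : (U P).label u = .write x v ↔ P.label u.1 = .bufWrite x v := by
  have hu := u.2
  change (P.label u.1).toPO = _ ↔ _
  generalize P.label u.1 = l at hu ⊢
  rcases l with (_ | _ | _) | _ <;> simp_all [TSOAct.toPO, TSOAct.isGlob]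

theorem label_U_eq_read_iff : (U P).label u = .read x v ↔ P.label u.1 = .po (.read x v) := by
  change (P.label u.1).toPO = _ ↔ _
  rcases P.label u.1 with (_ | _ | _) | _ <;> simp [TSOAct.toPO]

theorem isWriteTo_label_U_iff : ((U P).label u).IsWriteTo x ↔ BufTo P x u.1 :=
  exists_congr fun _ => label_U_eq_write_iff

theorem rep_of_isBuf (h : (P.label u.1).isBuf = true) : rep P ω u = (ω ⟨u.1, h⟩).1 := dif_pos h

theorem rep_of_not_isBuf (h : ¬ (P.label u.1).isBuf = true) : rep P ω u = u.1 := dif_neg h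

theorem rep_of_isRead (h : ((U P).label u).IsRead) : rep P ω u = u.1 := by
  obtain ⟨x, v, h⟩ := h
  exact rep_of_not_isBuf (by simp [label_U_eq_read_iff.1 h, TSOAct.isBuf])

theorem rep_injective : Function.Injective (rep P ω) := by
  intro u w heq
  by_cases hu : (P.label u.1).isBuf = true <;> by_cases hw : (P.label w.1).isBuf = true
  · rw [rep_of_isBuf hu, rep_of_isBuf hw] at heq
    exact Subtype.ext (Subtype.mk.inj (ω.injective (Subtype.ext heq)))
  · rw [rep_of_isBuf hu, rep_of_not_isBuf hw] at heq
    exact absurd (heq ▸ (ω ⟨u.1, hu⟩).2) w.2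
  · rw [rep_of_not_isBuf hu, rep_of_isBuf hw] at heq
    exact absurd (heq ▸ (ω ⟨w.1, hw⟩).2) u.2
  · rw [rep_of_not_isBuf hu, rep_of_not_isBuf hw] at heq
    exact Subtype.ext heq

theorem TSOAct.not_isGlob_of_isBuf {l : TSOAct Loc V} (h : l.isBuf = true) :
    ¬ l.isGlob = true := by
  rcases l with (_ | _ | _) | _ <;> simp_all [TSOAct.isBuf, TSOAct.isGlob]

theorem exists_rep_eq (g : GlobOcc P) : ∃ u, rep P ω u = g.1 := by
  have hbuf := (ω.symm g).2
  refine ⟨⟨(ω.symm g).1, TSOAct.not_isGlob_of_isBuf hbuf⟩, (rep_of_isBuf hbuf).trans ?_⟩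
  rw [Subtype.coe_eta, ω.apply_symm_apply]

theorem IsBalancing.label_rep (h : IsBalancing P ω) (u : (U P).Occ) :
    P.label (rep P ω u) = .po ((U P).label u) := by
  by_cases hu : (P.label u.1).isBuf = true
  · obtain ⟨x, v, hl⟩ : ∃ x v, P.label u.1 = .bufWrite x v := by
      rcases hl : P.label u.1 with _ | ⟨x, v⟩
      exacts [by simp [hl, TSOAct.isBuf] at hu, ⟨x, v, rfl⟩]
    rw [rep_of_isBuf hu, label_U_eq_write_iff.2 hl, h.label_glob_iff, hl]
  · rw [rep_of_not_isBuf hu]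
    change _ = TSOAct.po (P.label u.1).toPO
    rcases hl : P.label u.1 with _ | ⟨x, v⟩
    exacts [rfl, absurd (hl ▸ rfl) hu]

theorem IsBalancing.globTo_rep_iff (h : IsBalancing P ω) :
    GlobTo P x (rep P ω u) ↔ ((U P).label u).IsWriteTo x := by
  simp only [GlobTo, POAct.IsWriteTo, h.label_rep, TSOAct.po.injEq]

theorem rep_lt {a : P.Occ} (h : P.lt u.1 a)
    (hω : ∀ b : BufOcc P, b.1 = u.1 → P.lt (ω b).1 a) : P.lt (rep P ω u) a := by
  by_cases hu : (P.label u.1).isBuf = true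
  · exact rep_of_isBuf hu ▸ hω _ rfl
  · exact rep_of_not_isBuf hu ▸ h

theorem IsBalancing.lt_rep (h : IsBalancing P ω) {a : P.Occ} (hlt : P.lt a u.1) :
    P.lt a (rep P ω u) := by
  by_cases hu : (P.label u.1).isBuf = true
  · exact rep_of_isBuf hu ▸ P.trans _ _ _ hlt (h.below ⟨u.1, hu⟩)
  · exact rep_of_not_isBuf hu ▸ hlt

theorem IsBalancing.rep_lt_rep_of_isRead (h : IsBalancing P ω) (hu : ((U P).label u).IsRead)
    (hlt : (U P).lt u w) : P.lt (rep P ω u) (rep P ω w) :=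
  rep_of_isRead (ω := ω) hu ▸ h.lt_rep hlt

theorem IsBalancing.rep_lt_rep_of_isWrite (h : IsBalancing P ω) (hu : ((U P).label u).IsWrite)
    (hw : ((U P).label w).IsWrite) (hlt : (U P).lt u w) : P.lt (rep P ω u) (rep P ω w) := by
  obtain ⟨x, hx⟩ := hu
  obtain ⟨y, hy⟩ := hw
  have hu := (isWriteTo_label_U_iff.1 hx).isBuf
  have hw := (isWriteTo_label_U_iff.1 hy).isBuf
  rw [rep_of_isBuf hu, rep_of_isBuf hw]
  exact h.glob_lt_glob hlt

theorem incomp_U_iff : (U P).Incomp u w ↔ P.Incomp u.1 w.1 :=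
  and_congr_left' Subtype.ext_iff.not

theorem IsBalancing.rep_lt_rep_of_fork (h : IsBalancing P ω) {w' : (U P).Occ}
    (hlt : (U P).lt u w) (hlt' : (U P).lt u w') (hi : (U P).Incomp w w') :
    P.lt (rep P ω u) (rep P ω w) :=
  h.lt_rep <| rep_lt hlt fun _ hb =>
    h.glob_lt_of_fork (hb ▸ hlt) (hb ▸ hlt') (incomp_U_iff.1 hi)

theorem IsBalancing.rep_lt_rep_of_join (h : IsBalancing P ω) {u' : (U P).Occ}
    (hlt : (U P).lt u w) (hlt' : (U P).lt u' w) (hi : (U P).Incomp u u') :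
    P.lt (rep P ω u) (rep P ω w) :=
  h.lt_rep <| rep_lt hlt fun _ hb =>
    h.glob_lt_of_join (hb ▸ hlt) hlt' (hb ▸ incomp_U_iff.1 hi)

end Rep

/-! ### TSO-consistency of the order of representatives -/

section Consistency

variable {Loc V : Type*} {P : Pom (TSOAct Loc V)} {ω : BufOcc P ≃ GlobOcc P} {x : Loc} {v : V}
  {Λ : List P.Occ} {r : (U P).Occ} {σ τ : BState Loc V}

theorem isMaxIn_of_subset_lowerClosure {α : Type*} {lt : α → α → Prop} [IsStrictOrder α lt]
    {S : Set α} {w : α} (hw : w ∈ S) (h : S ⊆ lowerClosure lt w) : IsMaxIn lt S w := by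
  refine ⟨hw, fun w' hw' hlt => ?_⟩
  rcases h hw' with hlt' | rfl
  exacts [irrefl_of lt w (trans_of lt hlt hlt'), irrefl_of lt w' hlt]

theorem mem_writesBelow_iff_of_isRead {Q : Pom (POAct Loc V)} {lt : Q.Occ → Q.Occ → Prop}
    {r w : Q.Occ} (hr : (Q.label r).IsRead) :
    w ∈ writesBelow Q lt x r ↔ (Q.label w).IsWriteTo x ∧ lt w r := by
  refine and_congr_right fun ⟨u, hu⟩ => or_iff_left ?_
  rintro rfl
  obtain ⟨y, v, hr⟩ := hr
  simp [hr] at hu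

theorem mem_writes_map_inl_iff :
    (x, v) ∈ writes P (Λ.map .inl) ↔ ∃ a ∈ Λ, P.label a = .po (.write x v) := by
  simp [writes, TSOAct.written_eq_some_iff]

theorem lastVal_writes_eq_none_iff :
    lastVal x (writes P (Λ.map .inl)) = none ↔ ∀ a ∈ Λ, ¬ GlobTo P x a := by
  simp only [lastVal_eq_none_iff, mem_writes_map_inl_iff, GlobTo]
  grind

theorem exists_eq_append_of_lastVal_writes_eq_some
    (h : lastVal x (writes P (Λ.map .inl)) = some v) :
    ∃ Λ₁ g Λ₂, Λ = Λ₁ ++ g :: Λ₂ ∧ P.label g = .po (.write x v) ∧ ∀ a ∈ Λ₂, ¬ GlobTo P x a := by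
  obtain ⟨E₁, E₂, heq, hE₂⟩ := eq_append_of_lastVal_eq_some h
  rw [writes, List.filterMap_map] at heq
  obtain ⟨Λ₁, Λ', rfl, -, h'⟩ := List.filterMap_eq_append_iff.1 heq
  obtain ⟨Λ₂, g, Λ₃, rfl, -, hg, rfl⟩ := List.filterMap_eq_cons_iff.1 h'
  rw [← List.filterMap_map] at hE₂
  exact ⟨Λ₁ ++ Λ₂, g, Λ₃, by simp, TSOAct.written_eq_some_iff.1 hg,
    lastVal_writes_eq_none_iff.1 hE₂⟩

theorem MemRead.exists_append {a : P.Occ} (h : MemRead P x v (Λ.map .inl) σ a) :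
    ∃ Λ₁ Λ₂, Λ = Λ₁ ++ a :: Λ₂ ∧
      (lastVal x (writes P (Λ₁.map .inl))).or (σ.mem.toFun x) = some v := by
  obtain ⟨E₁, E₂, heq, hval⟩ := h
  obtain ⟨Λ₁, Λ', rfl, rfl, h'⟩ := List.map_eq_append_iff.1 heq
  obtain ⟨a', Λ₂, rfl, ha, -⟩ := List.map_eq_cons_iff.1 h'
  exact ⟨Λ₁, Λ₂, by rw [Sum.inl_injective ha], hval⟩

theorem mem_writesBelow_rep_iff (hbal : IsBalancing P ω) {Λ₁ Λ₂ : List P.Occ}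
    (hΛ : (Λ₁ ++ r.1 :: Λ₂).Nodup) (hr : ((U P).label r).IsRead) {w : (U P).Occ} :
    w ∈ writesBelow (U P) (rep P ω ⁻¹'o Precedes (Λ₁ ++ r.1 :: Λ₂)) x r ↔
      GlobTo P x (rep P ω w) ∧ rep P ω w ∈ Λ₁ := by
  rw [mem_writesBelow_iff_of_isRead hr, hbal.globTo_rep_iff, Order.Preimage, rep_of_isRead hr,
    precedes_append_cons_self_iff hΛ]

theorem MemRead.exists_last_write_or_eq_empty (hbal : IsBalancing P ω) (hΛ : Λ.Nodup)
    (hr : ((U P).label r).IsRead) (h : MemRead P x v (Λ.map .inl) σ r.1) :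
    (∃ w ∈ writesBelow (U P) (rep P ω ⁻¹'o Precedes Λ) x r, (U P).label w = .write x v ∧
      writesBelow (U P) (rep P ω ⁻¹'o Precedes Λ) x r ⊆
        lowerClosure (rep P ω ⁻¹'o Precedes Λ) w) ∨
    writesBelow (U P) (rep P ω ⁻¹'o Precedes Λ) x r = ∅ ∧ σ.mem.toFun x = some v := by
  obtain ⟨Λ₁, Λ₂, rfl, hval⟩ := h.exists_append
  cases hlast : lastVal x (writes P (Λ₁.map .inl)) with
  | none =>
    refine .inr ⟨Set.eq_empty_of_forall_notMem fun w hw => ?_, by simpa [hlast] using hval⟩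
    obtain ⟨hglob, hmem⟩ := (mem_writesBelow_rep_iff hbal hΛ hr).1 hw
    exact lastVal_writes_eq_none_iff.1 hlast _ hmem hglob
  | some v' =>
    obtain rfl : v' = v := by simpa [hlast] using hval
    obtain ⟨Λ₃, g, Λ₄, rfl, hg, hΛ₄⟩ := exists_eq_append_of_lastVal_writes_eq_some hlast
    obtain ⟨w, rfl⟩ := exists_rep_eq (ω := ω) ⟨g, GlobTo.isGlob ⟨v', hg⟩⟩
    have hmem := (mem_writesBelow_rep_iff hbal hΛ hr).2 ⟨⟨v', hg⟩, by simp⟩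
    refine .inl ⟨w, hmem, ?_, fun w' hw' => ?_⟩
    · simpa [hbal.label_rep] using hg
    · obtain ⟨hglob, hmem⟩ := (mem_writesBelow_rep_iff hbal hΛ hr).1 hw'
      rcases List.mem_append.1 hmem with hmem | hmem
      · left
        exact precedes_iff_append.2 ⟨Λ₃, rep P ω w :: (Λ₄ ++ r.1 :: Λ₂), by simp, hmem, by simp⟩
      · have heq := (List.mem_cons.1 hmem).resolve_right fun h => hΛ₄ _ h hglob
        exact .inr (rep_injective heq)

theorem Flushed.writesBelow_subset (hΛ : Λ ∈ P.Lin) (hr : ((U P).label r).IsRead)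
    (h : Flushed ω x r.1) :
    writesBelow (U P) (U P).lt x r ⊆ writesBelow (U P) (rep P ω ⁻¹'o Precedes Λ) x r := by
  intro w hw
  rw [mem_writesBelow_iff_of_isRead hr] at hw ⊢
  have hbuf := isWriteTo_label_U_iff.1 hw.1
  refine ⟨hw.1, hΛ.2 _ _ ?_⟩
  rw [rep_of_isRead hr, rep_of_isBuf hbuf.isBuf]
  exact h _ hbuf hw.2

theorem Forwarded.exists_isMaxIn (hΛ : Λ ∈ P.Lin) (hr : ((U P).label r).IsRead)
    (h : Forwarded ω x v r.1) :
    ∃ w, (U P).label w = .write x v ∧ IsMaxIn (U P).lt (writesBelow (U P) (U P).lt x r) w ∧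
      (rep P ω ⁻¹'o Precedes Λ) r w := by
  obtain ⟨b, hb, hbr, hrb, hmax⟩ := h
  let w : (U P).Occ := ⟨b.1, TSOAct.not_isGlob_of_isBuf b.2⟩
  have hw : (U P).label w = .write x v := label_U_eq_write_iff.2 hb
  refine ⟨w, hw, ⟨(mem_writesBelow_iff_of_isRead hr).2 ⟨⟨v, hw⟩, hbr⟩, fun w' hw' => ?_⟩,
    hΛ.2 _ _ ?_⟩
  · obtain ⟨hw', hlt⟩ := (mem_writesBelow_iff_of_isRead hr).1 hw'
    exact hmax w'.1 (isWriteTo_label_U_iff.1 hw') hlt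
  · rwa [rep_of_isRead hr, rep_of_isBuf (u := w) b.2]

theorem isStrictOrder_rep_preimage (hΛ : Λ.Nodup) :
    IsStrictOrder (U P).Occ (rep P ω ⁻¹'o Precedes Λ) :=
  have := isStrictOrder_precedes hΛ
  (RelEmbedding.preimage ⟨rep P ω, rep_injective⟩ (Precedes Λ)).isStrictOrder

theorem IsBalancing.tsoConsistentFrom (hbal : IsBalancing P ω) (hΛ : Λ ∈ P.Lin)
    (hfoot : (σ, τ) ∈ zfoot P Λ) :
    TSOConsistentFrom σ.mem (U P) (rep P ω ⁻¹'o Precedes Λ) where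
  strict := isStrictOrder_rep_preimage hΛ.1.1
  ordering _ _ _ _ hne := hΛ.1.precedes_or_precedes (rep_injective.ne hne)
  value r x v hread := by
    have := hΛ.1.finite
    have := isStrictOrder_rep_preimage (ω := ω) hΛ.1.1
    have hr : ((U P).label r).IsRead := ⟨x, v, hread⟩
    rcases resolved_of_mem_zfoot hbal hfoot (label_U_eq_read_iff.1 hread) with ⟨hM, hF⟩ | hF
    · have hsub := hF.writesBelow_subset hΛ hr
      rcases hM.exists_last_write_or_eq_empty hbal hΛ.1.1 hr with
        ⟨w, hmem, hw, hlast⟩ | ⟨hempty, hσ⟩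
      · exact .inl ⟨w, v, hw, isMaxIn_of_subset_lowerClosure hmem hlast, hsub.trans hlast, rfl⟩
      · exact .inr (.inr ⟨hempty, Set.subset_eq_empty hsub hempty, hσ⟩)
    · obtain ⟨w, hw, hmax, hrw⟩ := hF.exists_isMaxIn hΛ hr
      exact .inr (.inl ⟨w, v, hw, hmax, hrw, rfl⟩)
  loadOp _ _ hr hlt := hΛ.2 _ _ (hbal.rep_lt_rep_of_isRead hr hlt)
  storeStore _ _ hw hw' hlt := hΛ.2 _ _ (hbal.rep_lt_rep_of_isWrite hw hw' hlt)
  fork _ _ _ h₂ h₃ hi := ⟨hΛ.2 _ _ (hbal.rep_lt_rep_of_fork h₂ h₃ hi),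
    hΛ.2 _ _ (hbal.rep_lt_rep_of_fork h₃ h₂ hi.symm)⟩
  join _ _ _ h₁ h₂ hi := ⟨hΛ.2 _ _ (hbal.rep_lt_rep_of_join h₁ h₂ hi),
    hΛ.2 _ _ (hbal.rep_lt_rep_of_join h₂ h₁ hi.symm)⟩

end Consistency

/-! ### Invariance under isomorphism -/

section Iso

variable {α β : Type*} {lt : β → β → Prop}

theorem lowerClosure_preimage (e : α ≃ β) (a : α) :
    lowerClosure (e ⁻¹'o lt) a = e ⁻¹' lowerClosure lt (e a) := by
  simp [lowerClosure, Set.ext_iff, Order.Preimage]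

theorem isMaxIn_preimage_iff (e : α ≃ β) {S : Set β} {a : α} :
    IsMaxIn (e ⁻¹'o lt) (e ⁻¹' S) a ↔ IsMaxIn lt S (e a) := by
  simp only [IsMaxIn, e.surjective.forall, Set.mem_preimage, Order.Preimage]

theorem Pom.Iso.incomp_iff {L : Type*} {Q R : Pom L} (φ : Iso Q R) {a b : Q.Occ} :
    R.Incomp (φ.toEquiv a) (φ.toEquiv b) ↔ Q.Incomp a b := by
  simp only [Pom.Incomp, φ.lt_iff, ne_eq, φ.toEquiv.injective.eq_iff]

theorem Pom.Iso.preimage_lt {L : Type*} {Q R : Pom L} (φ : Iso Q R) :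
    φ.toEquiv ⁻¹'o R.lt = Q.lt := by
  ext a b
  exact φ.lt_iff a b

variable {Loc V : Type*} {Q R : Pom (POAct Loc V)}

theorem Pom.Iso.writesBelow_preimage (φ : Iso Q R) (lt : R.Occ → R.Occ → Prop) (x : Loc)
    (r : Q.Occ) : writesBelow Q (φ.toEquiv ⁻¹'o lt) x r =
      φ.toEquiv ⁻¹' writesBelow R lt x (φ.toEquiv r) := by
  simp only [writesBelow, lowerClosure_preimage, Set.preimage_inter, Set.preimage_ofPred_eq,
    φ.label_eq]

theorem TSOConsistentFrom.of_iso {σ : FinPart Loc V} (φ : Iso Q R) {T : R.Occ → R.Occ → Prop}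
    (h : TSOConsistentFrom σ Q (φ.toEquiv ⁻¹'o T)) : TSOConsistentFrom σ R T where
  strict :=
    have := h.strict
    (RelIso.preimage φ.toEquiv T).symm.toRelEmbedding.isStrictOrder
  ordering := by
    simp only [φ.toEquiv.surjective.forall, φ.label_eq, φ.toEquiv.injective.ne_iff]
    exact h.ordering
  value := by
    have hvalue := h.value
    simp only [← φ.preimage_lt, φ.writesBelow_preimage, lowerClosure_preimage,
      isMaxIn_preimage_iff, φ.toEquiv.surjective.preimage_subset_preimage_iff,
      φ.toEquiv.preimage_eq_iff_eq_image, Set.image_empty] at hvalue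
    simp only [φ.toEquiv.surjective.forall, φ.toEquiv.surjective.exists, φ.label_eq]
    exact hvalue
  loadOp := by
    simp only [φ.toEquiv.surjective.forall, φ.label_eq, φ.lt_iff]
    exact h.loadOp
  storeStore := by
    simp only [φ.toEquiv.surjective.forall, φ.label_eq, φ.lt_iff]
    exact h.storeStore
  fork := by
    simp only [φ.toEquiv.surjective.forall, φ.lt_iff, φ.incomp_iff]
    exact h.fork
  join := by
    simp only [φ.toEquiv.surjective.forall, φ.lt_iff, φ.incomp_iff]
    exact h.join

end Iso

end TSO

theorem mainTheorem1_general {Loc V : Type*} {P : TSO.Pom (TSO.POAct Loc V)} {L : List P.Occ}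
    (hL : L ∈ TSO.𝒯 P) : TSO.Pom.Enumerates L ∧ TSO.TSOConsistent P (TSO.Pom.Precedes L) := by
  obtain ⟨P', ω, φ, Λ, -, hbal, hΛ, ⟨⟨σ, τ⟩, hfoot⟩, hmap⟩ := hL
  have hinj : Function.Injective fun p => TSO.rep P' ω (φ.toEquiv.symm p) :=
    TSO.rep_injective.comp φ.toEquiv.symm.injective
  have hPO (u) : (P'.label (TSO.rep P' ω u)).isPO = true := by rw [hbal.label_rep]; rfl
  refine ⟨⟨.of_map _ (hmap ▸ hΛ.1.1.filter _), fun p => ?_⟩, σ.mem, .of_iso φ ?_⟩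
  · rw [← List.mem_map_of_injective hinj, hmap]
    exact List.mem_filter.2 ⟨hΛ.1.2 _, hPO _⟩
  · convert hbal.tsoConsistentFrom hΛ hfoot using 1
    ext a b
    rw [Order.Preimage, ← TSO.precedes_map_iff hinj, hmap]
    simpa using TSO.precedes_filter_iff (p := fun a => (P'.label a).isPO) (hPO a) (hPO b)

theorem mainTheorem1 (Loc V : Type*) :
    TSO.Sound (TSO.𝒯 : (P : TSO.Pom (TSO.POAct Loc V)) → Set (List P.Occ)) :=
  fun _ _ _ _ _ hL => mainTheorem1_general hL
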